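/- **Model.** $\mathrm{DTIME}(T)$ is taken over deterministic random-access Turing machines: finitely many states, work tapes with heads, and random-access tapes, where the scanned cell of a random-access tape is the one whose number is written in binary on an associated work tape (its address tape); cells hold $0$, $1$ or blank, and one step reads and rewrites all scanned cells, moves the heads and changes the state. A family $f=\{f_n\}_{n\ge1}$, $f_n:\{0,1\}^n\to\{0,1\}$, is in $\mathrm{DTIME}(T)$ if some such machine decides $f_n(x)$ for every $n\geq 1$ and $x\in\{0,1\}^n$, given $x$ on a random-access tape, in $O(T(n))$ steps. **Circuits.** For $d\ge1$, $f\in\mathbf{RC}_d(\tau)$ if, over some finite universal Boolean basis, there are circuits $C_n$ computing $f_n$ with $|C_n|=O(\tau(n)^d)$ gates and width $O(\tau(n)^{d-1})$. Here the inputs have level $0$, the level of a gate is one more than the largest level of its arguments, and the width is the maximum over $\ell\geq 0$ of the number of signals (inputs or gate outputs) of level $\le\ell$ that are read by a gate of level $>\ell$. The binary encoding $\langle C_n\rangle$ lists the gates in topological order (number, operation and arguments of each, with numbers in self-delimiting binary), then the output wire and $n$. **Uniformity.** $\{C_n\}$ is *globally $\mathrm{DTIME}(T)$-uniform* if a machine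 computes $\langle C_n\rangle$ from $1^n$, on a separate tape, in $O(T(n))$ steps for every $n\ge1$. It is *locally $\mathrm{DTIME}(T)$-uniform* if a machine transforms $\langle C_n\rangle$ into $\langle C_{n+1}\rangle$ in place on a random-access tape in $O(T(n))$ steps for every $n\ge1$, all other tapes being blank at the start and at the end. "$\mathbf{RC}_d(\tau)\subseteq\mathrm{DTIME}(T')$ under local (global) $\mathrm{DTIME}(T)$-uniformity" means that every $f$ for which there are circuits $C_n$ as in the definition of $\mathbf{RC}_d(\tau)$ that are moreover locally (globally) $\mathrm{DTIME}(T)$-uniform is in $\mathrm{DTIME}(T')$. **Theorem (Time correspondence).** Let $d\geq 1$ be an integer and let $t(n)>0$ be a real-valued time bound. 1. Let $d\ge2$, let $t$ be non-decreasing and $n=O(t(n))$. Then for every real $k\ge \frac d{d-1}$, under local $\mathrm{DTIME}(t(n)^{k/d})$-uniformity, $$\mathbf{RC}_d\bigl(t(n)^{k/d}\bigr)\subseteq \mathrm{DTIME}\bigl(t(n)^k\bigr).$$ 2. For every real $k$ (and without the assumptions of 1), the same containment holds under global $\mathrm{DTIME}(t(n)^k)$-uniformity. **Corollary (Ideal time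 complexity).** For every integer $d\ge2$, under local $\mathrm{DTIME}(n^{1/(d-1)})$-uniformity, $$\mathbf{RC}_d\bigl(n^{1/(d-1)}\bigr)\subseteq \mathrm{DTIME}\bigl(n^{d/(d-1)}\bigr).$$ -/

import Mathlib

open Asymptotics Filter

/-! ### Boolean circuits over a finite basis -/

/-- A finite Boolean basis: finitely many operations, each of a fixed arity (so the fan-in of
circuits over the basis is bounded by a constant). -/
structure GateBasis where
  numOps : ℕ
  arity : Fin numOps → ℕ
  op : (i : Fin numOps) → (Fin (arity i) → Bool) → Bool

/-- A circuit with `n` inputs, its gates listed in a topological order: every argument of gate `j`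
is an input (`inl`) or a gate with a smaller number (`inr`); `out` is the output wire. -/
structure Circuit (B : GateBasis) (n : ℕ) where
  /-- the number of gates -/
  size : ℕ
  gate : Fin size → Fin B.numOps
  arg : (j : Fin size) → Fin (B.arity (gate j)) → Fin n ⊕ Fin (j : ℕ)
  out : Fin n ⊕ Fin size

namespace Circuit

variable {B : GateBasis} {n : ℕ}

/-- The value of gate `j` on input `x`. -/
def gateVal (C : Circuit B n) (x : Fin n → Bool) (j : ℕ) (h : j < C.size) : Bool :=
  B.op (C.gate ⟨j, h⟩) fun a =>
    match C.arg ⟨j, h⟩ a with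
    | .inl i => x i
    | .inr l => C.gateVal x l.1 (l.2.trans h)
termination_by j
decreasing_by exact l.2

/-- The value at the output wire on input `x`. -/
def eval (C : Circuit B n) (x : Fin n → Bool) : Bool :=
  match C.out with
  | .inl i => x i
  | .inr j => C.gateVal x j.1 j.2

def Computes (C : Circuit B n) (f : (Fin n → Bool) → Bool) : Prop :=
  ∀ x, C.eval x = f x

/-- The level of gate `j`: one more than the largest level of its arguments, the inputs having
level `0`. -/
def gateLevel (C : Circuit B n) (j : ℕ) (h : j < C.size) : ℕ :=
  1 + Finset.univ.sup fun a : Fin (B.arity (C.gate ⟨j, h⟩)) =>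
    match C.arg ⟨j, h⟩ a with
    | .inl _ => 0
    | .inr l => C.gateLevel l.1 (l.2.trans h)
termination_by j
decreasing_by exact l.2

/-- The level of a signal, i.e. of an input or of the output of a gate. -/
def level (C : Circuit B n) : Fin n ⊕ Fin C.size → ℕ
  | .inl _ => 0
  | .inr j => C.gateLevel j.1 j.2

/-- The signal that is read by argument `a` of gate `j`. -/
def source (C : Circuit B n) (j : Fin C.size) (a : Fin (B.arity (C.gate j))) :
    Fin n ⊕ Fin C.size :=
  (C.arg j a).map id (Fin.castLE j.2.le)

/-- The signals that cross the cut between the levels `≤ ℓ` and the levels `> ℓ`. -/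
def crossing (C : Circuit B n) (ℓ : ℕ) : Set (Fin n ⊕ Fin C.size) :=
  {v | C.level v ≤ ℓ ∧ ∃ j a, C.source j a = v ∧ ℓ < C.level (.inr j)}

/-- The width: the largest number of one-bit signals crossing a cut between consecutive levels
(no gate has a level above `size`). -/
noncomputable def width (C : Circuit B n) : ℕ :=
  (Finset.range (C.size + 1)).sup fun ℓ => (C.crossing ℓ).ncard

end Circuit

/-- A basis is universal if its circuits compute all Boolean functions (of at least one input). -/
def GateBasis.Universal (B : GateBasis) : Prop :=
  ∀ (n : ℕ+) (f : (Fin n → Bool) → Bool), ∃ C : Circuit B n, C.Computes f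

/-! ### The encoding of circuits as binary strings -/

/-- Self-delimiting binary code of a number: each binary digit `b`, least significant first, is
written as `1 b`, and a single `0` ends the number. -/
def encNat (m : ℕ) : List Bool :=
  (Nat.bits m).flatMap (fun b => [true, b]) ++ [false]

def encWire {n s : ℕ} : Fin n ⊕ Fin s → List Bool
  | .inl i => false :: encNat i
  | .inr j => true :: encNat j

namespace Circuit

variable {B : GateBasis} {n : ℕ}

/-- The record of gate `j`: its number, its operation and its arguments. -/
def encGate (C : Circuit B n) (j : Fin C.size) : List Bool :=
  encNat j ++ encNat (C.gate j) ++ (List.ofFn fun a => encWire (C.arg j a)).flatten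

/-- The encoding of a circuit: the records of its gates, each announced by a `1`, then a `0`,
the output wire and the number of inputs. -/
def enc (C : Circuit B n) : List Bool :=
  (List.ofFn fun j => true :: C.encGate j).flatten ++ false :: (encWire C.out ++ encNat n)

end Circuit

/-! ### Random-access Turing machines -/

inductive HeadMove
  | left
  | stay
  | right

/-- A deterministic random-access Turing machine. It has finitely many work tapes with heads and
finitely many random-access tapes; the cell of a random-access tape that is scanned is the one
whose number is written in binary on an associated work tape (its address tape). Cells hold `0`,
`1` or blank (`none`). One step reads all scanned cells, rewrites them, moves the heads of the work
tapes and changes the state; the machine has halted when `δ` gives `none`. -/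
structure RATM where
  State : Type
  Work : Type
  Mem : Type
  [finState : Fintype State]
  [finWork : Fintype Work]
  [finMem : Fintype Mem]
  addr : Mem → Work
  start : State
  δ : State → (Work → Option Bool) → (Mem → Option Bool) →
    Option (State × (Work → Option Bool × HeadMove) × (Mem → Option Bool))

namespace RATM

/-- Cells are numbered by `ℕ`; `pos` gives the positions of the heads on the work tapes. -/
@[ext] structure Cfg (M : RATM) where
  state : M.State
  pos : M.Work → ℕ
  work : M.Work → ℕ → Option Bool
  mem : M.Mem → ℕ → Option Bool

variable (M : RATM)

/-- The number written on a tape: cell `i` is the binary digit of weight `2 ^ i` (all cells but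
finitely many are blank in every configuration that a computation reaches). -/
noncomputable def number (c : ℕ → Option Bool) : ℕ :=
  ∑ᶠ i ∈ {i : ℕ | c i = some true}, 2 ^ i

/-- A head that is told to move to the left from cell `0` stays there. -/
def movePos : HeadMove → ℕ → ℕ
  | .left, p => p - 1
  | .stay, p => p
  | .right, p => p + 1

variable {M}

/-- The number of the scanned cell of the random-access tape `r`. -/
noncomputable def Cfg.active (c : M.Cfg) (r : M.Mem) : ℕ := number (c.work (M.addr r))

noncomputable def step (c : M.Cfg) : Option M.Cfg :=
  (M.δ c.state (fun w => c.work w (c.pos w)) (fun r => c.mem r (c.active r))).map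
    fun ⟨q, a, b⟩ =>
      { state := q
        pos := fun w => movePos (a w).2 (c.pos w)
        work := fun w => Function.update (c.work w) (c.pos w) (a w).1
        mem := fun r => Function.update (c.mem r) (c.active r) (b r) }

/-- `c` leads to the halting configuration `c'` in at most `T` steps. -/
def HaltsWithin (c c' : M.Cfg) (T : ℕ) : Prop :=
  ∃ s ≤ T, (fun o : Option M.Cfg => o.bind step)^[s] (some c) = some c' ∧ step c' = none

open Classical in
/-- The configuration in state `q` with the word `w` on the random-access tape `r` (from cell `0`
on), all other cells blank and all heads at cell `0`. -/
noncomputable def cfgOf (q : M.State) (r : M.Mem) (w : List Bool) : M.Cfg where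
  state := q
  pos := fun _ => 0
  work := fun _ _ => none
  mem := fun r' i => if r' = r then w[i]? else none

end RATM

/-! ### Time classes and uniformity -/

/-- A family of Boolean functions, one for each input length `n ≥ 1`. -/
abbrev BoolFamily : Type := (n : ℕ+) → (Fin n → Bool) → Bool

/-- A family of circuits `C n` with `n` inputs, for `n ≥ 1`. -/
abbrev CircuitFamily (B : GateBasis) : Type := (n : ℕ+) → Circuit B n

/-- `DTIME(T)`: the families decided by a deterministic machine in `O(T(n))` steps on all inputs of
length `n`. -/
def DTIME (T : ℕ+ → ℝ) : Set BoolFamily :=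
  {f | ∃ (M : RATM) (inp : M.Mem) (acc : M.State → Bool) (τ : ℕ+ → ℕ),
    (fun n => (τ n : ℝ)) =O[atTop] T ∧
    ∀ (n : ℕ+) (x : Fin n → Bool), ∃ c,
      RATM.HaltsWithin (RATM.cfgOf M.start inp (List.ofFn x)) c (τ n) ∧ acc c.state = f n x}

/-- Global `DTIME(T)`-uniformity: some machine computes `C n` (encoded) from `1ⁿ` in `O(T(n))`
steps, with the input and the output on different tapes. -/
def GloballyUniform {B : GateBasis} (T : ℕ+ → ℝ) (C : CircuitFamily B) : Prop :=
  ∃ (M : RATM) (inp out : M.Mem) (τ : ℕ+ → ℕ), inp ≠ out ∧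
    (fun n => (τ n : ℝ)) =O[atTop] T ∧
    ∀ n : ℕ+, ∃ c,
      RATM.HaltsWithin (RATM.cfgOf M.start inp (List.replicate n true)) c (τ n) ∧
      c.mem out = fun i => (C n).enc[i]?

/-- Local `DTIME(T)`-uniformity: some machine transforms `C n` into `C (n + 1)` (both encoded) in
`O(T(n))` steps. It works in place, so that `T(n)` bounds the cost of the edits and may be smaller
than the length of the encodings; all other tapes are blank at the start and at the end. -/
def LocallyUniform {B : GateBasis} (T : ℕ+ → ℝ) (C : CircuitFamily B) : Prop :=
  ∃ (M : RATM) (io : M.Mem) (τ : ℕ+ → ℕ),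
    (fun n => (τ n : ℝ)) =O[atTop] T ∧
    ∀ n : ℕ+, ∃ q : M.State,
      RATM.HaltsWithin (RATM.cfgOf M.start io (C n).enc)
        (RATM.cfgOf q io (C (n + 1)).enc) (τ n)

/-! ### Realizable circuits -/

/-- The circuits `C n` compute `f` and satisfy the size and width bounds of dimension `d` and time
cost `t`. -/
structure Realizes {B : GateBasis} (d : ℕ) (t : ℕ+ → ℝ) (C : CircuitFamily B)
    (f : BoolFamily) : Prop where
  computes : ∀ n, (C n).Computes (f n)
  size_le : (fun n => ((C n).size : ℝ)) =O[atTop] fun n => t n ^ d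
  width_le : (fun n => ((C n).width : ℝ)) =O[atTop] fun n => t n ^ (d - 1)

/-- The class `RC_d(t)`, without any uniformity. -/
def RC (d : ℕ) (t : ℕ+ → ℝ) : Set BoolFamily :=
  {f | ∃ B : GateBasis, B.Universal ∧ ∃ C : CircuitFamily B, Realizes d t C f}

/-- The class `RC_d(t)` under global `DTIME(T)`-uniformity. -/
def globalRC (d : ℕ) (t T : ℕ+ → ℝ) : Set BoolFamily :=
  {f | ∃ B : GateBasis, B.Universal ∧ ∃ C : CircuitFamily B,
    Realizes d t C f ∧ GloballyUniform T C}

/-- The class `RC_d(t)` under local `DTIME(T)`-uniformity. -/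
def localRC (d : ℕ) (t T : ℕ+ → ℝ) : Set BoolFamily :=
  {f | ∃ B : GateBasis, B.Universal ∧ ∃ C : CircuitFamily B,
    Realizes d t C f ∧ LocallyUniform T C}

/-! Everything reduces to one statement, `mem_DTIME_of_globallyUniform`: if a machine `M` generates
the encoding of `C n` from `1ⁿ` in time `τ n`, then the function computed by `C n` can be decided in
time `O(τ n)`. The decider runs `M` and then evaluates the circuit in one sequential pass over its
encoding. The records come in topological order, so the arguments of a gate already stand on a
random-access tape of values; looking up a wire costs time linear in the code of its number, and
operations are read into the finite control. The pass is therefore linear in the length of the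
encoding, and this length is at most the running time of `M`, since a step changes only one cell of
the output tape.

Three points need care. No relation between `T(n)` and `n` is available, so there may be no time to
write `1ⁿ` next to the input `x`. Instead `M` is made to see `1ⁿ` in place of `x`: a flag tells
which cells of its input tape `M` has rewritten, and an unflagged cell counts as `1` when the
corresponding cell of `x` is not blank (`runsIn_simulate`). The generated encoding stands on a
random-access tape and is copied to a work tape by counting through its addresses; an increment has
amortized constant cost, with the number of digits `1` as potential (`runsIn_increment`,
`runsIn_copyMem`). Finally, heads cannot detect the end of a tape, so each work tape of `M` gets a
parallel tape of marks by which its head returns to cell `0` and its content is erased.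

Local uniformity is reduced to global uniformity: write the constant word `⟨C 1⟩` and apply the
update machine `n - 1` times, counting through the cells of the input (`runsIn_generator`). The cost
is `O(n)` plus a sum of fewer than `n` terms, which for monotone `t` with `n = O(t)` is `O(t ^ (1 +
k / d))`. The inequality `1 + k / d ≤ k` is equivalent to `k ≥ d / (d - 1)`. The ideal time bound is
the case `t n = n`, `k = d / (d - 1)`. -/

/-! ### Tape programs -/

/-- The tapes of a random-access machine. -/
structure TapeSig where
  Work : Type
  Mem : Type
  [finWork : Fintype Work]
  [finMem : Fintype Mem]
  addr : Mem → Work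

attribute [instance] TapeSig.finWork TapeSig.finMem

/-- The contents of all tapes and the positions of the heads. -/
@[ext] structure Store (S : TapeSig) where
  pos : S.Work → ℕ
  work : S.Work → ℕ → Option Bool
  mem : S.Mem → ℕ → Option Bool

/-- What one step does to the tapes. -/
abbrev Act (S : TapeSig) : Type := (S.Work → Option Bool × HeadMove) × (S.Mem → Option Bool)

namespace Act

variable {S : TapeSig}

def noop (wr : S.Work → Option Bool) (mr : S.Mem → Option Bool) : Act S :=
  (fun w => (wr w, .stay), mr)

open Classical in
noncomputable def setWork (a : Act S) (w : S.Work) (v : Option Bool) (mv : HeadMove) : Act S :=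
  (Function.update a.1 w (v, mv), a.2)

open Classical in
noncomputable def setMem (a : Act S) (r : S.Mem) (v : Option Bool) : Act S :=
  (a.1, Function.update a.2 r v)

end Act

namespace Store

variable {S : TapeSig}

noncomputable def active (s : Store S) (r : S.Mem) : ℕ := RATM.number (s.work (S.addr r))

def workRead (s : Store S) : S.Work → Option Bool := fun w => s.work w (s.pos w)

noncomputable def memRead (s : Store S) : S.Mem → Option Bool := fun r => s.mem r (s.active r)

noncomputable def apply (s : Store S) (a : Act S) : Store S where
  pos := fun w => RATM.movePos (a.1 w).2 (s.pos w)
  work := fun w => Function.update (s.work w) (s.pos w) (a.1 w).1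
  mem := fun r => Function.update (s.mem r) (s.active r) (a.2 r)

open Classical in
/-- Replace the head position and the contents of a work tape. -/
noncomputable def putWork (s : Store S) (w : S.Work) (p : ℕ) (c : ℕ → Option Bool) : Store S where
  pos := Function.update s.pos w p
  work := Function.update s.work w c
  mem := s.mem

open Classical in
/-- Replace the contents of a random-access tape. -/
noncomputable def putMem (s : Store S) (r : S.Mem) (c : ℕ → Option Bool) : Store S where
  pos := s.pos
  work := s.work
  mem := Function.update s.mem r c

section lemmas

variable (s : Store S) (w w' : S.Work) (p q : ℕ) (c e : ℕ → Option Bool) (r r' : S.Mem)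

@[simp] theorem putWork_pos_self : (s.putWork w p c).pos w = p := by simp [putWork]
@[simp] theorem putWork_work_self : (s.putWork w p c).work w = c := by simp [putWork]
@[simp] theorem putWork_mem : (s.putWork w p c).mem = s.mem := rfl
@[simp] theorem putMem_pos : (s.putMem r c).pos = s.pos := rfl
@[simp] theorem putMem_work : (s.putMem r c).work = s.work := rfl
@[simp] theorem putMem_mem_self : (s.putMem r c).mem r = c := by simp [putMem]

variable {w w' r r'}

theorem putWork_pos_ne (h : w' ≠ w) : (s.putWork w p c).pos w' = s.pos w' := by
  simp [putWork, h]

theorem putWork_work_ne (h : w' ≠ w) : (s.putWork w p c).work w' = s.work w' := by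
  simp [putWork, h]

theorem putMem_mem_ne (h : r' ≠ r) : (s.putMem r c).mem r' = s.mem r' := by
  simp [putMem, h]

@[simp] theorem putWork_putWork : (s.putWork w p c).putWork w q e = s.putWork w q e := by
  simp [putWork]

theorem putWork_comm (h : w ≠ w') :
    (s.putWork w p c).putWork w' q e = (s.putWork w' q e).putWork w p c := by
  classical simp [putWork, Function.update_comm h.symm]

@[simp] theorem putWork_self : s.putWork w (s.pos w) (s.work w) = s := by
  simp [putWork]

@[simp] theorem apply_noop : s.apply (Act.noop s.workRead s.memRead) = s := by
  ext <;> simp [apply, Act.noop, workRead, memRead, RATM.movePos]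

theorem apply_setWork (a : Act S) (v : Option Bool) (mv : HeadMove) :
    s.apply (a.setWork w v mv) = (s.apply a).putWork w (RATM.movePos mv (s.pos w))
      (Function.update (s.work w) (s.pos w) v) := by
  ext w'
  · by_cases h : w' = w
    · subst h; simp [apply, Act.setWork]
    · simp [apply, Act.setWork, putWork, h]
  · by_cases h : w' = w
    · subst h; simp [apply, Act.setWork]
    · simp [apply, Act.setWork, putWork, h]
  · simp [apply, Act.setWork]

theorem apply_setMem (a : Act S) (v : Option Bool) :
    s.apply (a.setMem r v) = (s.apply a).putMem r (Function.update (s.mem r) (s.active r) v) := by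
  ext r'
  · simp [apply, Act.setMem]
  · simp [apply, Act.setMem]
  · by_cases h : r' = r
    · subst h; simp [apply, Act.setMem]
    · simp [apply, Act.setMem, putMem, h]

end lemmas

end Store

/-- A program with finite control over the tapes `S`; it exits with a result of type `R`, and its
exit takes no step. -/
structure Prog (S : TapeSig) (R : Type) where
  State : Type
  [finState : Fintype State]
  start : State
  δ : State → (S.Work → Option Bool) → (S.Mem → Option Bool) → (State × Act S) ⊕ R

attribute [instance] Prog.finState

/-! ### Runs of programs, their composition, and their translation into machines -/

namespace Prog

variable {S : TapeSig} {R A : Type}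

/-- From state `q` and store `s` the program exits with `r` and store `s'` after the given number
of steps. -/
inductive RunsFrom (p : Prog S R) : p.State → Store S → R → Store S → ℕ → Prop
  | exit {q s r} : p.δ q s.workRead s.memRead = .inr r → RunsFrom p q s r s 0
  | step {q s q' a r s' T} : p.δ q s.workRead s.memRead = .inl (q', a) →
      RunsFrom p q' (s.apply a) r s' T → RunsFrom p q s r s' (T + 1)

/-- The program, started on the store `s`, exits with `r` and store `s'` within `T` steps. -/
def RunsIn (p : Prog S R) (s : Store S) (r : R) (s' : Store S) (T : ℕ) : Prop :=
  ∃ T' ≤ T, RunsFrom p p.start s r s' T'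

theorem RunsIn.mono {p : Prog S R} {s s' : Store S} {r : R} {T T' : ℕ} (h : RunsIn p s r s' T)
    (hT : T ≤ T') : RunsIn p s r s' T' :=
  let ⟨U, hU, hr⟩ := h
  ⟨U, hU.trans hT, hr⟩

/-- The common core of `bind` and `iter`: a state map that respects all steps carries a run over,
and `he` supplies what the larger program does where the smaller one exits. -/
theorem RunsFrom.lift {B : Type} {p : Prog S A} {p' : Prog S B} (φ : p.State → p'.State)
    (hs : ∀ st wr mr st' a, p.δ st wr mr = .inl (st', a) → p'.δ (φ st) wr mr = .inl (φ st', a))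
    {st : p.State} {s s' s'' : Store S} {r : A} {r' : B} {T T' : ℕ}
    (h : RunsFrom p st s r s' T)
    (he : ∀ st, p.δ st s'.workRead s'.memRead = .inr r → RunsFrom p' (φ st) s' r' s'' T') :
    RunsFrom p' (φ st) s r' s'' (T + T') := by
  induction h with
  | exit e => rw [Nat.zero_add]; exact he _ e
  | @step _ _ _ _ _ _ T e _ ih =>
    rw [show T + 1 + T' = T + T' + 1 by omega]
    exact .step (hs _ _ _ _ _ e) (ih he)

/-- Exit at once, with a result that depends on the scanned cells. -/
def test (f : (S.Work → Option Bool) → (S.Mem → Option Bool) → R) : Prog S R where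
  State := Unit
  start := ()
  δ := fun _ wr mr => .inr (f wr mr)

theorem runsIn_test (f : (S.Work → Option Bool) → (S.Mem → Option Bool) → R) (s : Store S) :
    RunsIn (test f) s (f s.workRead s.memRead) s 0 :=
  ⟨0, le_rfl, .exit rfl⟩

/-- Exit at once. -/
def pure (r : R) : Prog S R := test fun _ _ => r

theorem runsIn_pure (r : R) (s : Store S) : RunsIn (pure r) s r s 0 :=
  runsIn_test _ s

/-- Make one step. -/
def act [Fintype R] (f : (S.Work → Option Bool) → (S.Mem → Option Bool) → Act S × R) :
    Prog S R where
  State := Option R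
  start := none
  δ := fun q wr mr => match q with
    | none => .inl (some (f wr mr).2, (f wr mr).1)
    | some r => .inr r

theorem runsIn_act [Fintype R]
    (f : (S.Work → Option Bool) → (S.Mem → Option Bool) → Act S × R) (s : Store S) :
    RunsIn (act f) s (f s.workRead s.memRead).2 (s.apply (f s.workRead s.memRead).1) 1 :=
  ⟨1, le_rfl, .step (T := 0) rfl (.exit rfl)⟩

/-- Run `p` and then, depending on its result, one of the programs `q`. -/
def bind [Fintype A] (p : Prog S A) (q : A → Prog S R) : Prog S R where
  State := p.State ⊕ Σ a, (q a).State
  start := .inl p.start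
  δ := fun st wr mr => match st with
    | .inl st => match p.δ st wr mr with
      | .inl (st', a) => .inl (.inl st', a)
      | .inr a => .inl (.inr ⟨a, (q a).start⟩, Act.noop wr mr)
    | .inr ⟨a, st⟩ => match (q a).δ st wr mr with
      | .inl (st', b) => .inl (.inr ⟨a, st'⟩, b)
      | .inr r => .inr r

/-- The additional step hands control from `p` to `q a`; it writes back what it scans and moves no
head. -/
theorem RunsIn.bind [Fintype A] {p : Prog S A} {q : A → Prog S R} {s s' s'' : Store S} {a : A}
    {r : R} {T T' : ℕ} (h : RunsIn p s a s' T) (h' : RunsIn (q a) s' r s'' T') :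
    RunsIn (p.bind q) s r s'' (T + T' + 1) := by
  obtain ⟨U, hU, h⟩ := h
  obtain ⟨U', hU', h'⟩ := h'
  have key : RunsFrom (p.bind q) (.inr ⟨a, (q a).start⟩) s' r s'' (U' + 0) :=
    h'.lift (p' := p.bind q) (fun st => .inr ⟨a, st⟩)
      (fun st wr mr st' b e => by simp only [Prog.bind, e])
      fun st e => .exit (by simp only [Prog.bind, e])
  refine ⟨U + (U' + 0 + 1), by omega, h.lift (p' := p.bind q) (fun st => .inl st)
      (fun st wr mr st' b e => by simp only [Prog.bind, e]) fun st e => ?_⟩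
  refine .step (p := p.bind q) (q' := .inr ⟨a, (q a).start⟩)
    (a := Act.noop s'.workRead s'.memRead) ?_ ?_
  · simp only [Prog.bind, e]
  · rw [Store.apply_noop]; exact key

/-- Run `p a`, go on with `p a'` if the result is `inl a'`, and exit with `r` if it is `inr r`. -/
def iter [Fintype A] (p : A → Prog S (A ⊕ R)) (a : A) : Prog S R where
  State := Σ a, (p a).State
  start := ⟨a, (p a).start⟩
  δ := fun st wr mr => match (p st.1).δ st.2 wr mr with
    | .inl (st', b) => .inl (⟨st.1, st'⟩, b)
    | .inr (.inl a') => .inl (⟨a', (p a').start⟩, Act.noop wr mr)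
    | .inr (.inr r) => .inr r

theorem RunsIn.iter_exit [Fintype A] {p : A → Prog S (A ⊕ R)} {a : A} {s s' : Store S} {r : R}
    {T : ℕ} (h : RunsIn (p a) s (.inr r) s' T) : RunsIn (iter p a) s r s' T := by
  obtain ⟨U, hU, h⟩ := h
  exact ⟨U + 0, by omega, h.lift (p' := iter p a) (fun st => ⟨a, st⟩)
    (fun st wr mr st' b e => by simp only [iter, e]) fun st e => .exit (by simp only [iter, e])⟩

/-- `iter p a` and `iter p a'` have the same transitions and differ only in the start state, so a
run of the second continues the first after one step for the jump. -/
theorem RunsIn.iter_step [Fintype A] {p : A → Prog S (A ⊕ R)} {a a' : A} {s s' s'' : Store S}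
    {r : R} {T T' : ℕ} (h : RunsIn (p a) s (.inl a') s' T) (h' : RunsIn (iter p a') s' r s'' T') :
    RunsIn (iter p a) s r s'' (T + T' + 1) := by
  obtain ⟨U, hU, h⟩ := h
  obtain ⟨U', hU', h'⟩ := h'
  have key : RunsFrom (iter p a) ⟨a', (p a').start⟩ s' r s'' (U' + 0) :=
    RunsFrom.lift (p := iter p a') (p' := iter p a) (fun st => st)
      (fun st wr mr st' b e => e) h' fun st e => .exit e
  refine ⟨U + (U' + 0 + 1), by omega, h.lift (p' := iter p a) (fun st => ⟨a, st⟩)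
      (fun st wr mr st' b e => by simp only [iter, e]) fun st e => ?_⟩
  refine .step (p := iter p a) (q' := ⟨a', (p a').start⟩)
    (a := Act.noop s'.workRead s'.memRead) ?_ ?_
  · simp only [iter, e]
  · rw [Store.apply_noop]; exact key

/-- The random-access machine that runs a program; its halting states carry the result. -/
def toRATM [Fintype R] (p : Prog S R) : RATM where
  State := p.State ⊕ R
  Work := S.Work
  Mem := S.Mem
  addr := S.addr
  start := .inl p.start
  δ := fun st wr mr => match st with
    | .inl st => match p.δ st wr mr with
      | .inl (st', a) => some (.inl st', a)
      | .inr r => some (.inr r, Act.noop wr mr)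
    | .inr _ => none

/-- The configuration of `toRATM` in a given state. -/
def cfg [Fintype R] (p : Prog S R) (q : p.State ⊕ R) (s : Store S) : p.toRATM.Cfg where
  state := q
  pos := s.pos
  work := s.work
  mem := s.mem

theorem step_cfg_of_inl [Fintype R] {p : Prog S R} {q q' : p.State} {s : Store S} {a : Act S}
    (h : p.δ q s.workRead s.memRead = .inl (q', a)) :
    RATM.step (p.cfg (.inl q) s) = some (p.cfg (.inl q') (s.apply a)) := by
  change Option.map _ (match p.δ q s.workRead s.memRead with
      | .inl (st', a) => some (Sum.inl st', a)
      | .inr r => some (.inr r, Act.noop s.workRead s.memRead)) = _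
  rw [h]
  rfl

theorem step_cfg_of_inr [Fintype R] {p : Prog S R} {q : p.State} {s : Store S} {r : R}
    (h : p.δ q s.workRead s.memRead = .inr r) :
    RATM.step (p.cfg (.inl q) s) = some (p.cfg (.inr r) s) := by
  have e : RATM.step (p.cfg (.inl q) s) =
      some (p.cfg (.inr r) (s.apply (Act.noop s.workRead s.memRead))) := by
    change Option.map _ (match p.δ q s.workRead s.memRead with
        | .inl (st', a) => some (Sum.inl st', a)
        | .inr r => some (.inr r, Act.noop s.workRead s.memRead)) = _
    rw [h]
    rfl
  rw [e, Store.apply_noop]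

theorem RunsIn.haltsWithin [Fintype R] {p : Prog S R} {s s' : Store S} {r : R} {T : ℕ}
    (h : RunsIn p s r s' T) :
    RATM.HaltsWithin (p.cfg (.inl p.start) s) (p.cfg (.inr r) s') (T + 1) := by
  obtain ⟨U, hU, h⟩ := h
  refine ⟨U + 1, by omega, ?_, rfl⟩
  clear hU
  revert h
  generalize p.start = st
  intro h
  induction h with
  | exit e => simp [step_cfg_of_inr e]
  | step e _ ih =>
    rw [Function.iterate_succ_apply]
    simpa only [Option.bind_some, step_cfg_of_inl e] using ih

end Prog

/-- A step-by-step simulation of a computation of `M` gives a run of the program. -/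
theorem RATM.HaltsWithin.runsIn {M : RATM} {S : TapeSig} {R : Type} {p : Prog S R}
    {c c' : M.Cfg} {T : ℕ} (h : RATM.HaltsWithin c c' T)
    (Rel : ℕ → M.Cfg → p.State → Store S → Prop) {s : Store S} (h₀ : Rel 0 c p.start s)
    (hstep : ∀ n c c' q s, Rel n c q s → RATM.step c = some c' →
      ∃ q' a, p.δ q s.workRead s.memRead = .inl (q', a) ∧ Rel (n + 1) c' q' (s.apply a))
    (hexit : ∀ n c q s, Rel n c q s → RATM.step c = none →
      ∃ r, p.δ q s.workRead s.memRead = .inr r) :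
    ∃ r n q s', n ≤ T ∧ Rel n c' q s' ∧ p.RunsIn s r s' T := by
  obtain ⟨U, hU, hc, hn⟩ := h
  suffices H : ∀ U n c q s, Rel n c q s →
      (fun o : Option M.Cfg => o.bind RATM.step)^[U] (some c) = some c' →
      ∃ r q' s', Rel (n + U) c' q' s' ∧ p.RunsFrom q s r s' U by
    obtain ⟨r, q', s', h1, h2⟩ := H U 0 c p.start s h₀ hc
    rw [Nat.zero_add] at h1
    exact ⟨r, U, q', s', hU, h1, U, hU, h2⟩
  clear h₀ hc hU
  intro U
  induction U with
  | zero =>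
    intro n c q s hR hc
    obtain rfl : c = c' := by simpa using hc
    obtain ⟨r, hr⟩ := hexit n c q s hR hn
    exact ⟨r, q, s, hR, .exit hr⟩
  | succ U ih =>
    intro n c q s hR hc
    rw [Function.iterate_succ_apply] at hc
    simp only [Option.bind_some] at hc
    cases hs : RATM.step c with
    | none =>
      -- `none` is a fixed point of the iteration, so no configuration can follow a halt.
      rw [hs, Function.iterate_fixed (by rfl)] at hc
      cases hc
    | some c₁ =>
      rw [hs] at hc
      obtain ⟨q₁, a, ha, hR₁⟩ := hstep n c c₁ q s hR hs
      obtain ⟨r, q', s', h1, h2⟩ := ih (n + 1) c₁ q₁ _ hR₁ hc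
      exact ⟨r, q', s', by rwa [show n + (U + 1) = n + 1 + U by omega], .step ha h2⟩

/-! ### Numbers and words on tapes -/

/-- The binary digits of `m`, with blanks for zeros. -/
def bitsTape (m : ℕ) : ℕ → Option Bool := fun i => if m.testBit i then some true else none

/-- The word `l` from cell `p` on, all other cells being blank. -/
def wordTape (p : ℕ) (l : List Bool) : ℕ → Option Bool := fun i => if i < p then none else l[i - p]?

/-- The tape that marks the cells up to `m` as visited, and cell `0` as the leftmost one. -/
def visited (m : ℕ) : ℕ → Option Bool := fun i => if i ≤ m then some (decide (i = 0)) else none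

/-- The word `l` stands on the tape `c` from cell `p` on. -/
def WordAt (c : ℕ → Option Bool) (p : ℕ) (l : List Bool) : Prop :=
  ∀ i < l.length, c (p + i) = l[i]?

/-- Only the cells that hold `1` matter for `number`. Hence a counter may use blanks for zeros,
while numbers read from an encoding keep theirs. -/
theorem number_eq_of_testBit {c : ℕ → Option Bool} {m : ℕ}
    (h : ∀ i, c i = some true ↔ m.testBit i = true) : RATM.number c = m := by
  have e : {i : ℕ | c i = some true} = (m.bitIndices.toFinset : Set ℕ) := by
    ext i; simp [h]
  rw [RATM.number, e, finsum_mem_coe_finset]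
  simp

@[simp] theorem number_bitsTape (m : ℕ) : RATM.number (bitsTape m) = m :=
  number_eq_of_testBit fun i => by simp [bitsTape]

@[simp] theorem number_wordTape_bits (m : ℕ) : RATM.number (wordTape 0 (Nat.bits m)) = m :=
  number_eq_of_testBit fun i => by
    rw [Nat.testBit_eq_inth, List.getI_eq_getElem?_getD]
    simp only [wordTape, Nat.not_lt_zero, if_false, Nat.sub_zero]
    cases (Nat.bits m)[i]? <;> simp

@[simp] theorem bitsTape_zero : bitsTape 0 = fun _ => none := by
  ext; simp [bitsTape]

@[simp] theorem wordTape_nil (p : ℕ) : wordTape p [] = fun _ => none := by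
  ext; simp [wordTape]

theorem wordTape_zero (l : List Bool) : wordTape 0 l = fun i => l[i]? := by
  ext; simp [wordTape]

theorem update_wordTape_append (p : ℕ) (l : List Bool) (b : Bool) :
    Function.update (wordTape p l) (p + l.length) (some b) = wordTape p (l ++ [b]) := by
  ext1 i
  rcases eq_or_ne i (p + l.length) with rfl | h
  · simp [wordTape]
  · rw [Function.update_of_ne h]
    simp only [wordTape]
    split_ifs with h1
    · rfl
    · rcases lt_or_ge (i - p) l.length with h2 | h2
      · rw [List.getElem?_append_left h2]
      · rw [List.getElem?_eq_none h2, List.getElem?_eq_none (by simp; omega)]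

theorem update_wordTape_cons (p : ℕ) (l : List Bool) (b : Bool) :
    Function.update (wordTape p (b :: l)) p none = wordTape (p + 1) l := by
  ext1 i
  rcases eq_or_ne i p with rfl | h
  · simp [wordTape]
  · rw [Function.update_of_ne h]
    simp only [wordTape]
    rcases lt_or_ge i p with h1 | h1
    · simp [h1, Nat.lt_succ_of_lt h1]
    · rw [if_neg (by omega), if_neg (by omega), show i - p = (i - (p + 1)) + 1 by omega,
        List.getElem?_cons_succ]

theorem wordAt_wordTape (p : ℕ) (l : List Bool) : WordAt (wordTape p l) p l := by
  intro i _; simp [wordTape]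

theorem wordAt_cons {c : ℕ → Option Bool} {p : ℕ} {b : Bool} {l : List Bool} :
    WordAt c p (b :: l) ↔ c p = some b ∧ WordAt c (p + 1) l := by
  constructor
  · intro h
    refine ⟨by simpa using h 0 (by simp), fun i hi => ?_⟩
    have := h (i + 1) (by simpa using hi)
    rwa [List.getElem?_cons_succ, show p + (i + 1) = p + 1 + i by omega] at this
  · rintro ⟨h0, h⟩ i hi
    cases i with
    | zero => simpa using h0
    | succ i =>
      rw [List.getElem?_cons_succ, show p + (i + 1) = p + 1 + i by omega]
      exact h i (by simpa using hi)

theorem wordAt_append {c : ℕ → Option Bool} {p : ℕ} {l l' : List Bool} :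
    WordAt c p (l ++ l') ↔ WordAt c p l ∧ WordAt c (p + l.length) l' := by
  induction l generalizing p with
  | nil => simp [WordAt]
  | cons b l ih =>
    rw [List.cons_append, wordAt_cons, wordAt_cons, ih, and_assoc, List.length_cons,
      show p + 1 + l.length = p + (l.length + 1) by omega]

/-- A head moves by at most one cell, so the visited cells stay an initial segment; `getD false`
keeps the special mark of cell `0`. -/
theorem update_visited {m p : ℕ} (hp : p ≤ m + 1) :
    Function.update (visited m) p (some ((visited m p).getD false)) = visited (max m p) := by
  ext1 i
  rcases eq_or_ne i p with rfl | h
  · simp only [Function.update_self, visited, le_max_right, if_true]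
    split_ifs with h1
    · rfl
    · simp; omega
  · rw [Function.update_of_ne h]
    simp only [visited]
    congr 1
    simp; omega

theorem visited_eq_true {m i : ℕ} : visited m i = some true ↔ i = 0 := by
  simp only [visited]
  split_ifs with h
  · simp
  · simp; omega

theorem visited_isSome {m i : ℕ} : (visited m i).isSome ↔ i ≤ m := by
  simp only [visited]
  split_ifs with h <;> simp [h]

theorem length_encNat (m : ℕ) : (encNat m).length = 2 * (Nat.bits m).length + 1 := by
  simp [encNat, mul_comm]

namespace Store

variable {S : TapeSig}

theorem putWork_putWork_putWork_putWork (s : Store S) {w w' : S.Work} (h : w ≠ w')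
    (p p' q q' : ℕ) (c c' e e' : ℕ → Option Bool) :
    (((s.putWork w p c).putWork w' p' c').putWork w q e).putWork w' q' e' =
      (s.putWork w q e).putWork w' q' e' := by
  rw [putWork_comm _ _ _ _ _ h.symm, putWork_putWork, putWork_putWork]

theorem putWork_eq_self (s : Store S) {w : S.Work} {p : ℕ} {c : ℕ → Option Bool}
    (hp : s.pos w = p) (hc : s.work w = c) : s.putWork w p c = s := by
  subst hp hc; simp

end Store

/-! ### Elementary programs -/

namespace Prog

variable {S : TapeSig}

theorem RunsIn.act {R : Type} [Fintype R]
    {f : (S.Work → Option Bool) → (S.Mem → Option Bool) → Act S × R} {s s' : Store S} {r : R}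
    (hr : (f s.workRead s.memRead).2 = r)
    (hs : s.apply (f s.workRead s.memRead).1 = s') : RunsIn (act f) s r s' 1 := by
  subst hr hs; exact runsIn_act f s

/-- Move a head. -/
noncomputable def move (w : S.Work) (mv : HeadMove) : Prog S Unit :=
  act fun wr mr => ((Act.noop wr mr).setWork w (wr w) mv, ())

theorem runsIn_move (w : S.Work) (mv : HeadMove) (s : Store S) :
    RunsIn (move w mv) s () (s.putWork w (RATM.movePos mv (s.pos w)) (s.work w)) 1 :=
  .act rfl (by rw [Store.apply_setWork, Store.apply_noop]; simp [Store.workRead])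

/-- Write a symbol and move the head. -/
noncomputable def write (w : S.Work) (b : Option Bool) (mv : HeadMove) : Prog S Unit :=
  act fun wr mr => ((Act.noop wr mr).setWork w b mv, ())

theorem runsIn_write (w : S.Work) (b : Option Bool) (mv : HeadMove) (s : Store S) :
    RunsIn (write w b mv) s () (s.putWork w (RATM.movePos mv (s.pos w))
      (Function.update (s.work w) (s.pos w) b)) 1 :=
  .act rfl (by rw [Store.apply_setWork, Store.apply_noop])

/-- Write a symbol on a random-access tape. -/
noncomputable def store (r : S.Mem) (b : Option Bool) : Prog S Unit :=
  act fun wr mr => ((Act.noop wr mr).setMem r b, ())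

theorem runsIn_store (r : S.Mem) (b : Option Bool) (s : Store S) :
    RunsIn (store r b) s () (s.putMem r (Function.update (s.mem r) (s.active r) b)) 1 :=
  .act rfl (by rw [Store.apply_setMem, Store.apply_noop])

theorem RunsIn.congr {R : Type} {p : Prog S R} {s s' s'' : Store S} {r : R} {T T' : ℕ}
    (h : RunsIn p s r s' T) (hs : s' = s'') (hT : T ≤ T') : RunsIn p s r s'' T' :=
  hs ▸ h.mono hT

/-- Read a symbol and move the head to the right. -/
noncomputable def readBit {R : Type} [Fintype R] (w : S.Work) (g : Bool → R) : Prog S R :=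
  act fun wr mr => ((Act.noop wr mr).setWork w (wr w) .right, g ((wr w).getD false))

theorem runsIn_readBit {R : Type} [Fintype R] {w : S.Work} {g : Bool → R} {s : Store S} {b : Bool}
    (h : s.work w (s.pos w) = some b) :
    RunsIn (readBit w g) s (g b) (s.putWork w (s.pos w + 1) (s.work w)) 1 :=
  .act (by simp [Store.workRead, h])
    (by rw [Store.apply_setWork, Store.apply_noop]; simp [Store.workRead, RATM.movePos])

/-- Copy a symbol from `w` to `w'` and move both heads to the right. -/
noncomputable def copyBit {R : Type} [Fintype R] (w w' : S.Work) (r : R) : Prog S R :=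
  act fun wr mr =>
    (((Act.noop wr mr).setWork w (wr w) .right).setWork w' (wr w) .right, r)

theorem runsIn_copyBit {R : Type} [Fintype R] (w w' : S.Work) (r : R) (s : Store S) :
    RunsIn (copyBit w w' r) s r ((s.putWork w (s.pos w + 1) (s.work w)).putWork w' (s.pos w' + 1)
      (Function.update (s.work w') (s.pos w') (s.work w (s.pos w)))) 1 :=
  .act rfl (by
    rw [Store.apply_setWork, Store.apply_setWork, Store.apply_noop]
    simp [Store.workRead, RATM.movePos])

/-- Read the digits of a number from `w` and write them on `w'`. -/
noncomputable def readNum (w w' : S.Work) : Prog S Unit :=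
  iter (fun d : Bool => if d then copyBit w w' (.inl false)
    else readBit w fun b => if b then .inl true else .inr ()) false

/-- Generalized over the digits `l` already copied. The state of `iter` tells whether the next cell
is a digit or an announcing bit. -/
theorem runsIn_readDigits {w w' : S.Work} (hw : w ≠ w') (bs l : List Bool) (q : ℕ) (s : Store S)
    (h : WordAt (s.work w) (s.pos w) (bs.flatMap (fun b => [true, b]) ++ [false]))
    (hp : s.pos w' = q + l.length) (hc : s.work w' = wordTape q l) :
    RunsIn (readNum w w') s ()
      ((s.putWork w (s.pos w + 2 * bs.length + 1) (s.work w)).putWork w'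
        (q + (l ++ bs).length) (wordTape q (l ++ bs))) (4 * bs.length + 1) := by
  induction bs generalizing l s with
  | nil =>
    refine (RunsIn.iter_exit (runsIn_readBit
      (g := fun b => if b then Sum.inl true else Sum.inr ()) (wordAt_cons.1 h).1)).congr ?_ (by simp)
    rw [List.append_nil, Store.putWork_eq_self (s.putWork w _ _)
      (by simp [Store.putWork_pos_ne _ _ _ hw.symm, hp])
      (by simp [Store.putWork_work_ne _ _ _ hw.symm, hc])]
    rfl
  | cons b bs ih =>
    obtain ⟨h0, h⟩ := wordAt_cons.1 h
    obtain ⟨h1, h⟩ := wordAt_cons.1 h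
    refine (RunsIn.iter_step (runsIn_readBit
      (g := fun b => if b then Sum.inl true else Sum.inr ()) h0)
      (RunsIn.iter_step (runsIn_copyBit w w' (Sum.inl false) _) (ih (l ++ [b]) _ ?_ ?_ ?_))).congr
      ?_ (by simp; omega)
    · simp only [Store.putWork_work_ne _ _ _ hw, Store.putWork_pos_ne _ _ _ hw,
        Store.putWork_work_self, Store.putWork_pos_self]
      exact h
    · simp [Store.putWork_pos_ne _ _ _ hw.symm, hp, add_assoc]
    · simp [Store.putWork_work_ne _ _ _ hw.symm, Store.putWork_pos_ne _ _ _ hw.symm, hc, hp, h1,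
        update_wordTape_append]
    · rw [Store.putWork_putWork_putWork_putWork _ hw]
      simp [Store.putWork_work_ne _ _ _ hw, Store.putWork_pos_ne _ _ _ hw, mul_add, add_assoc]
      congr 2; omega

theorem runsIn_readNum {w w' : S.Work} (hw : w ≠ w') {m q : ℕ} {s : Store S}
    (h : WordAt (s.work w) (s.pos w) (encNat m))
    (hp : s.pos w' = q) (hc : s.work w' = fun _ => none) :
    RunsIn (readNum w w') s ()
      ((s.putWork w (s.pos w + (encNat m).length) (s.work w)).putWork w'
        (q + (Nat.bits m).length) (wordTape q (Nat.bits m))) (2 * (encNat m).length) := by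
  refine (runsIn_readDigits hw (Nat.bits m) [] q s h (by simpa) (by simpa)).congr ?_ ?_
  · rw [length_encNat]; rfl
  · rw [length_encNat]; omega

/-- Erase a word when the head stands behind it. -/
noncomputable def eraseWord (w : S.Work) : Prog S Unit :=
  (move w .left).bind fun _ => iter (fun _ : Unit => act fun wr mr =>
    ((Act.noop wr mr).setWork w none .left, if (wr w).isSome then .inl () else .inr ())) ()

/-- No mark is needed here: a head sent left from cell `0` stays there and then scans the blank it
has just written, which ends the loop. -/
theorem runsIn_eraseWord {w : S.Work} {l : List Bool} {s : Store S}
    (hp : s.pos w = l.length) (hc : s.work w = wordTape 0 l) :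
    RunsIn (eraseWord w) s () (s.putWork w 0 fun _ => none) (2 * l.length + 3) := by
  suffices H : ∀ (l : List Bool) (s : Store S), s.pos w = l.length - 1 → s.work w = wordTape 0 l →
      RunsIn (iter (fun _ : Unit => act fun wr mr =>
        ((Act.noop wr mr).setWork w none .left, if (wr w).isSome then Sum.inl () else .inr ())) ())
        s () (s.putWork w 0 fun _ => none) (2 * l.length + 1) by
    refine ((runsIn_move w .left s).bind (H l _ ?_ ?_)).congr (by simp) (by omega)
    · simp [RATM.movePos, hp]
    · simp [hc]
  intro l
  induction l using List.reverseRecOn with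
  | nil =>
    intro s hp hc
    refine RunsIn.iter_exit (.act ?_ ?_)
    · simp [Store.workRead, hc]
    · rw [Store.apply_setWork, Store.apply_noop, hc, hp]
      simp [RATM.movePos]
  | append_singleton l b ih =>
    intro s hp hc
    have hp' : s.pos w = l.length := by simpa using hp
    have hu : Function.update (s.work w) (s.pos w) none = wordTape 0 l := by
      have := update_wordTape_append 0 l b
      rw [Nat.zero_add] at this
      rw [hc, hp', ← this, Function.update_idem, Function.update_eq_self_iff]
      simp [wordTape]
    refine (RunsIn.iter_step (a' := ()) (.act ?_ rfl) (ih _ ?_ ?_)).congr ?_ ?_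
    · simp [Store.workRead, hc, hp', wordTape]
    · rw [Store.apply_setWork]; simp [RATM.movePos, hp']
    · rw [Store.apply_setWork]; simp [hu]
    · rw [Store.apply_setWork, Store.apply_noop]; simp
    · simp; omega

/-- Move the head back to the start of a word that follows a blank. -/
noncomputable def rewind (w : S.Work) : Prog S Unit :=
  (move w .left).bind fun _ => iter (fun _ : Unit => act fun wr mr =>
    if (wr w).isSome then ((Act.noop wr mr).setWork w (wr w) .left, .inl ())
    else ((Act.noop wr mr).setWork w (wr w) .right, .inr ())) ()

/-- The word is kept intact, so the blank cell `p - 1` must stop the head. This is why the encoding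
and the scratch words start at cell `1` or later. -/
theorem runsIn_rewind {w : S.Work} {p : ℕ} {l : List Bool} {s : Store S} (h1 : 1 ≤ p)
    (hp : s.pos w = p + l.length) (hc : s.work w = wordTape p l) :
    RunsIn (rewind w) s () (s.putWork w p (s.work w)) (2 * l.length + 3) := by
  suffices H : ∀ (k : ℕ) (s : Store S), k ≤ l.length → s.pos w = p + k - 1 →
      s.work w = wordTape p l →
      RunsIn (iter (fun _ : Unit => act fun wr mr =>
        if (wr w).isSome then ((Act.noop wr mr).setWork w (wr w) .left, Sum.inl ())
        else ((Act.noop wr mr).setWork w (wr w) .right, .inr ())) ())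
        s () (s.putWork w p (s.work w)) (2 * k + 1) by
    refine ((runsIn_move w .left s).bind (H l.length _ le_rfl ?_ ?_)).congr (by simp) (by omega)
    · simp [RATM.movePos, hp]
    · simp [hc]
  intro k
  induction k with
  | zero =>
    intro s _ hp hc
    have hr : s.workRead w = none := by
      simp [Store.workRead, hc, hp, wordTape]; omega
    refine RunsIn.iter_exit (.act ?_ ?_)
    · simp [hr]
    · simp only [hr, Option.isSome_none, Bool.false_eq_true, if_false]
      rw [Store.apply_setWork, Store.apply_noop, ← hr]
      simp [RATM.movePos, Store.workRead, hp, Nat.sub_add_cancel h1]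
  | succ k ih =>
    intro s hk hp hc
    have hr : (s.workRead w).isSome := by
      have : k < l.length := by omega
      simp [Store.workRead, hc, hp, wordTape, this]
    refine (RunsIn.iter_step (a' := ()) (.act ?_ rfl) (ih _ (by omega) ?_ ?_)).congr ?_ ?_
    · simp [hr]
    · simp only [hr, if_true]; rw [Store.apply_setWork]; simp [RATM.movePos, hp]
    · simp only [hr, if_true]; rw [Store.apply_setWork]; simp [Store.workRead, hc]
    · simp only [hr, if_true]; rw [Store.apply_setWork, Store.apply_noop]
      simp [Store.workRead]
    · omega

/-- Move a word from `w` to `w'`. -/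
noncomputable def moveWord (w w' : S.Work) : Prog S Unit :=
  iter (fun _ : Unit => act fun wr mr =>
    if (wr w).isSome then
      (((Act.noop wr mr).setWork w none .right).setWork w' (wr w) .right, .inl ())
    else (Act.noop wr mr, .inr ())) ()

theorem runsIn_moveWord {w w' : S.Work} (hw : w ≠ w') (l l' : List Bool) (q : ℕ) (s : Store S)
    (hc : s.work w = wordTape (s.pos w) l)
    (hp' : s.pos w' = q + l'.length) (hc' : s.work w' = wordTape q l') :
    RunsIn (moveWord w w') s () ((s.putWork w (s.pos w + l.length) fun _ => none).putWork w'
      (q + (l' ++ l).length) (wordTape q (l' ++ l))) (2 * l.length + 1) := by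
  induction l generalizing l' s with
  | nil =>
    have hr : s.workRead w = none := by simp [Store.workRead, hc]
    refine RunsIn.iter_exit (.act ?_ ?_)
    · simp [hr]
    · simp only [hr, Option.isSome_none, Bool.false_eq_true, if_false]
      rw [Store.apply_noop, Store.putWork_eq_self s (by simp) (by simpa using hc),
        Store.putWork_eq_self s (by simpa) (by simpa)]
  | cons b l ih =>
    have hr : s.workRead w = some b := by simp [Store.workRead, hc, wordTape]
    have e : s.apply (((Act.noop s.workRead s.memRead).setWork w none .right).setWork w'
        (some b) .right) = (s.putWork w (s.pos w + 1) (wordTape (s.pos w + 1) l)).putWork w'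
          (q + (l' ++ [b]).length) (wordTape q (l' ++ [b])) := by
      rw [Store.apply_setWork, Store.apply_setWork, Store.apply_noop, ← update_wordTape_append,
        ← update_wordTape_cons (b := b), ← hc, ← hc', hp']
      simp [RATM.movePos, add_assoc]
    refine (RunsIn.iter_step (a' := ()) (.act ?_ ?_) (ih (l' ++ [b])
      ((s.putWork w (s.pos w + 1) (wordTape (s.pos w + 1) l)).putWork w'
          (q + (l' ++ [b]).length) (wordTape q (l' ++ [b]))) ?_ ?_ ?_)).congr ?_ ?_
    · simp [hr]
    · simp only [hr, Option.isSome_some, if_true]; exact e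
    · simp [Store.putWork_work_ne _ _ _ hw, Store.putWork_pos_ne _ _ _ hw]
    · simp
    · simp
    · rw [Store.putWork_putWork_putWork_putWork _ hw]
      simp [Store.putWork_pos_ne _ _ _ hw, add_assoc, add_comm, add_left_comm]
    · simp; omega

end Prog

/-! ### Evaluation of an encoded circuit -/

/-- The tapes on which a circuit is evaluated: the encoding `enc`, a scratch tape, and the address
tapes of the input and of the values of the gates. -/
structure EvalTapes (S : TapeSig) where
  enc : S.Work
  scratch : S.Work
  inAddr : S.Work
  valAddr : S.Work
  inp : S.Mem
  val : S.Mem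
  addr_inp : S.addr inp = inAddr
  addr_val : S.addr val = valAddr
  inp_ne_val : inp ≠ val
  enc_ne_scratch : enc ≠ scratch
  enc_ne_inAddr : enc ≠ inAddr
  enc_ne_valAddr : enc ≠ valAddr
  scratch_ne_inAddr : scratch ≠ inAddr
  scratch_ne_valAddr : scratch ≠ valAddr
  inAddr_ne_valAddr : inAddr ≠ valAddr

namespace EvalTapes

variable {S : TapeSig} (K : EvalTapes S)

attribute [simp] addr_inp addr_val inp_ne_val enc_ne_scratch enc_ne_inAddr enc_ne_valAddr
  scratch_ne_inAddr scratch_ne_valAddr inAddr_ne_valAddr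

@[simp] theorem val_ne_inp : K.val ≠ K.inp := K.inp_ne_val.symm
@[simp] theorem scratch_ne_enc : K.scratch ≠ K.enc := K.enc_ne_scratch.symm
@[simp] theorem inAddr_ne_enc : K.inAddr ≠ K.enc := K.enc_ne_inAddr.symm
@[simp] theorem valAddr_ne_enc : K.valAddr ≠ K.enc := K.enc_ne_valAddr.symm
@[simp] theorem inAddr_ne_scratch : K.inAddr ≠ K.scratch := K.scratch_ne_inAddr.symm
@[simp] theorem valAddr_ne_scratch : K.valAddr ≠ K.scratch := K.scratch_ne_valAddr.symm
@[simp] theorem valAddr_ne_inAddr : K.valAddr ≠ K.inAddr := K.inAddr_ne_valAddr.symm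

/-- The state of the evaluation tapes between two phases: the head of `enc` is at `p`, the scratch
tape holds `l` from cell `q` on, and the address tapes are blank. -/
structure Inv (s : Store S) (c : ℕ → Option Bool) (p q : ℕ) (l : List Bool) {n : ℕ}
    (x : Fin n → Bool) (v : ℕ → Option Bool) : Prop where
  enc_work : s.work K.enc = c
  enc_pos : s.pos K.enc = p
  one_le : 1 ≤ q
  scratch_work : s.work K.scratch = wordTape q l
  scratch_pos : s.pos K.scratch = q + l.length
  inAddr_work : s.work K.inAddr = fun _ => none
  inAddr_pos : s.pos K.inAddr = 0
  valAddr_work : s.work K.valAddr = fun _ => none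
  valAddr_pos : s.pos K.valAddr = 0
  inp_mem : s.mem K.inp = fun i => (List.ofFn x)[i]?
  val_mem : s.mem K.val = v

end EvalTapes

namespace Prog

variable {S : TapeSig} (K : EvalTapes S)

/-- Read a number from `w` and look up the cell with this number of the random-access tape `r`. -/
noncomputable def lookup (w : S.Work) (r : S.Mem) : Prog S Bool :=
  (readNum w (S.addr r)).bind fun _ => (test fun _ mr => (mr r).getD false).bind fun b =>
    (eraseWord (S.addr r)).bind fun _ => pure b

theorem runsIn_lookup {w : S.Work} {r : S.Mem} (hr : w ≠ S.addr r) {s : Store S} {m : ℕ} {b : Bool}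
    (hw : WordAt (s.work w) (s.pos w) (encNat m)) (hp : s.pos (S.addr r) = 0)
    (hc : s.work (S.addr r) = fun _ => none) (hb : s.mem r m = some b) :
    RunsIn (lookup w r) s b (s.putWork w (s.pos w + (encNat m).length) (s.work w))
      (3 * (encNat m).length + 5) := by
  have r1 := runsIn_readNum hr hw hp hc
  set s1 := (s.putWork w (s.pos w + (encNat m).length) (s.work w)).putWork (S.addr r)
        (0 + (Nat.bits m).length) (wordTape 0 (Nat.bits m)) with hs1
  have r2 := runsIn_test (fun _ mr => (mr r).getD false) s1
  have e2 : (s1.memRead r).getD false = b := by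
    simp [Store.memRead, Store.active, hs1, hb]
  rw [e2] at r2
  have r3 := runsIn_eraseWord (s := s1) (w := S.addr r) (l := Nat.bits m) (by simp [hs1])
    (by simp [hs1])
  refine (r1.bind (r2.bind (r3.bind (runsIn_pure b _)))).congr ?_ ?_
  · rw [hs1, Store.putWork_putWork, Store.putWork_eq_self (s.putWork w _ _)]
    · rw [Store.putWork_pos_ne _ _ _ hr.symm, hp]
    · rw [Store.putWork_work_ne _ _ _ hr.symm, hc]
  · have := length_encNat m; omega

/-- Read a wire from `enc` and look up its value. -/
noncomputable def readWire : Prog S Bool :=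
  (readBit K.enc id).bind fun g => lookup K.enc (if g then K.val else K.inp)

/-- Read the values of `k` wires. -/
noncomputable def readWires : (k : ℕ) → Prog S (Fin k → Bool)
  | 0 => pure Fin.elim0
  | k + 1 => (readWire K).bind fun b => (readWires k).bind fun v => pure (Fin.cons b v)

variable {K} {n : ℕ} {x : Fin n → Bool} {s : Store S} {c v : ℕ → Option Bool} {p q : ℕ}
  {l : List Bool}

theorem runsIn_readWire (h : K.Inv s c p q l x v) {j : ℕ} {u : Fin n ⊕ Fin j}
    (hw : WordAt c p (encWire u)) {y : Fin j → Bool} (hv : ∀ i : Fin j, v i = some (y i)) :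
    RunsIn (readWire K) s (Sum.elim x y u) (s.putWork K.enc (p + (encWire u).length) c)
      (5 * (encWire u).length) := by
  obtain ⟨rfl, rfl, -, -, -, h4, h5, h6, h7, h8, h9⟩ := h
  cases u with
  | inl i =>
    rw [encWire] at hw ⊢
    obtain ⟨h0, hw⟩ := wordAt_cons.1 hw
    have r1 := runsIn_readBit (g := id) h0
    have r2 := runsIn_lookup (w := K.enc) (r := K.inp) (m := i) (b := x i) (by simp)
      (s := s.putWork K.enc (s.pos K.enc + 1) (s.work K.enc)) (by simpa using hw)
      (by simp [Store.putWork_pos_ne, h5]) (by simp [Store.putWork_work_ne, h4])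
      (by simp [h8])
    refine (r1.bind r2).congr ?_ ?_
    · simp [add_assoc, add_comm 1]
    · have := length_encNat i; simp only [List.length_cons]; omega
  | inr i =>
    rw [encWire] at hw ⊢
    obtain ⟨h0, hw⟩ := wordAt_cons.1 hw
    have r1 := runsIn_readBit (g := id) h0
    have r2 := runsIn_lookup (w := K.enc) (r := K.val) (m := i) (b := y i) (by simp)
      (s := s.putWork K.enc (s.pos K.enc + 1) (s.work K.enc)) (by simpa using hw)
      (by simp [Store.putWork_pos_ne, h7]) (by simp [Store.putWork_work_ne, h6])
      (by simp [h9, hv])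
    refine (r1.bind r2).congr ?_ ?_
    · simp [add_assoc, add_comm 1]
    · have := length_encNat i; simp only [List.length_cons]; omega

theorem _root_.EvalTapes.Inv.putEnc (h : K.Inv s c p q l x v) (p' : ℕ) :
    K.Inv (s.putWork K.enc p' c) c p' q l x v := by
  obtain ⟨h1, h2, h3, h4, h5, h6, h7, h8, h9, h10, h11⟩ := h
  constructor <;> simp [Store.putWork_pos_ne, Store.putWork_work_ne, *]

/-- Pays for the two control steps that `readWires` spends on each wire. -/
theorem length_encWire {n j : ℕ} (u : Fin n ⊕ Fin j) : 2 ≤ (encWire u).length := by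
  cases u <;> simp [encWire, length_encNat]

theorem runsIn_readWires {j : ℕ} {y : Fin j → Bool} (hv : ∀ i : Fin j, v i = some (y i)) {k : ℕ}
    (h : K.Inv s c p q l x v) {u : Fin k → Fin n ⊕ Fin j}
    (hw : WordAt c p (List.ofFn fun a => encWire (u a)).flatten) :
    RunsIn (readWires K k) s (fun a => Sum.elim x y (u a))
      (s.putWork K.enc (p + (List.ofFn fun a => encWire (u a)).flatten.length) c)
      (6 * (List.ofFn fun a => encWire (u a)).flatten.length) := by
  induction k generalizing s p with
  | zero =>
    rw [show (fun a => Sum.elim x y (u a)) = Fin.elim0 from funext fun a => a.elim0]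
    refine (runsIn_pure _ s).congr ?_ (by simp)
    simp [Store.putWork_eq_self s h.enc_pos h.enc_work]
  | succ k ih =>
    rw [List.ofFn_succ, List.flatten_cons] at hw ⊢
    obtain ⟨hw0, hw⟩ := wordAt_append.1 hw
    have r1 := runsIn_readWire h hw0 hv
    have r2 := ih (h.putEnc _) (u := fun a => u a.succ) hw
    rw [show (fun a => Sum.elim x y (u a)) =
      Fin.cons (Sum.elim x y (u 0)) (fun a => Sum.elim x y (u a.succ)) from by
        ext a; cases a using Fin.cases <;> rfl]
    refine (r1.bind (r2.bind (runsIn_pure (Fin.cons (Sum.elim x y (u 0))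
      (fun a => Sum.elim x y (u a.succ)) : Fin (k + 1) → Bool) _))).congr ?_ ?_
    · simp [add_assoc]
    · have := length_encWire (u 0); simp only [List.length_append]; omega

/-- Words of bounded length. -/
abbrev BoundedWord (N : ℕ) : Type := {l : List Bool // l.length ≤ N}

noncomputable instance (N : ℕ) : Fintype (BoundedWord N) :=
  (List.finite_length_le Bool N).fintype

/-- Append a digit, unless the word has become too long. -/
def BoundedWord.push {N : ℕ} (l : BoundedWord N) (b : Bool) : BoundedWord N :=
  if h : (l.1 ++ [b]).length ≤ N then ⟨l.1 ++ [b], h⟩ else l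

open Classical in
/-- The number below `N` with the given digits. -/
noncomputable def BoundedWord.decode {N : ℕ} (l : BoundedWord N) : Option (Fin N) :=
  if h : ∃ o : Fin N, Nat.bits o = l.1 then some h.choose else none

theorem bits_injective : Function.Injective Nat.bits := fun a b h =>
  Nat.eq_of_testBit_eq fun i => by rw [Nat.testBit_eq_inth, Nat.testBit_eq_inth, h]

theorem BoundedWord.decode_eq {N : ℕ} {l : BoundedWord N} {o : Fin N} (h : Nat.bits o = l.1) :
    l.decode = some o := by
  have h' : ∃ o : Fin N, Nat.bits o = l.1 := ⟨o, h⟩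
  rw [decode, dif_pos h']
  exact congrArg some (Fin.ext (bits_injective (h'.choose_spec.trans h.symm)))

/-- Read a number below `N` into the finite control. -/
noncomputable def readFin (w : S.Work) (N : ℕ) : Prog S (Option (Fin N)) :=
  iter (fun a : Bool × BoundedWord N =>
    if a.1 then readBit w fun b => .inl (false, a.2.push b)
    else readBit w fun b => if b then .inl (true, a.2) else .inr a.2.decode)
    (false, ⟨[], Nat.zero_le N⟩)

theorem runsIn_readFin {w : S.Work} {N : ℕ} {o : Fin N}
    (h : WordAt (s.work w) (s.pos w) (encNat o)) :
    RunsIn (readFin w N) s (some o) (s.putWork w (s.pos w + (encNat o).length) (s.work w))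
      (2 * (encNat o).length) := by
  -- Hence `push` never meets its default case while the digits of `o` are read.
  have hN : (Nat.bits o).length ≤ N := by
    rw [Nat.size_eq_bits_len, Nat.size_le]
    exact o.2.trans Nat.lt_two_pow_self
  suffices H : ∀ (bs l : List Bool) (s : Store S) (hl : l.length ≤ N), l ++ bs = Nat.bits o →
      WordAt (s.work w) (s.pos w) (bs.flatMap (fun b => [true, b]) ++ [false]) →
      RunsIn (iter (fun a : Bool × BoundedWord N =>
        if a.1 then readBit w fun b => .inl (false, a.2.push b)
        else readBit w fun b => if b then .inl (true, a.2) else .inr a.2.decode) (false, ⟨l, hl⟩))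
        s (some o) (s.putWork w (s.pos w + 2 * bs.length + 1) (s.work w)) (4 * bs.length + 1) by
    refine (H (Nat.bits o) [] s (Nat.zero_le N) rfl h).congr ?_ ?_
    · rw [length_encNat, add_assoc]
    · rw [length_encNat]; omega
  clear h
  intro bs
  induction bs with
  | nil =>
    intro l s hl ho h
    refine RunsIn.iter_exit ?_
    have := runsIn_readBit (g := fun b => if b then
      Sum.inl (true, (⟨l, hl⟩ : BoundedWord N)) else Sum.inr (BoundedWord.decode ⟨l, hl⟩))
      (wordAt_cons.1 h).1
    simp only [Bool.false_eq_true, if_false,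
      BoundedWord.decode_eq (l := ⟨l, hl⟩) (by simpa using ho.symm)] at this ⊢
    exact this
  | cons b bs ih =>
    intro l s hl ho h
    obtain ⟨h0, h⟩ := wordAt_cons.1 h
    obtain ⟨h1, h⟩ := wordAt_cons.1 h
    have hl' : (l ++ [b]).length ≤ N := by
      have := congrArg List.length ho
      simp at this ⊢; omega
    have r1 := runsIn_readBit (g := fun b => if b then
      Sum.inl (true, (⟨l, hl⟩ : BoundedWord N)) else Sum.inr (BoundedWord.decode ⟨l, hl⟩)) h0
    have r2 := runsIn_readBit (s := s.putWork w (s.pos w + 1) (s.work w)) (w := w) (b := b)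
      (g := fun b => (Sum.inl (false, BoundedWord.push (⟨l, hl⟩ : BoundedWord N) b) :
        (Bool × BoundedWord N) ⊕ Option (Fin N))) (by simpa using h1)
    rw [show BoundedWord.push ⟨l, hl⟩ b = (⟨l ++ [b], hl'⟩ : BoundedWord N) from dif_pos hl'] at r2
    have r3 := ih (l ++ [b]) ((s.putWork w (s.pos w + 1) (s.work w)).putWork w
      (s.pos w + 1 + 1) (s.work w)) hl' (by simpa using ho) (by
        rw [Store.putWork_work_self, Store.putWork_pos_self]; exact h)
    simp only [Store.putWork_work_self, Store.putWork_pos_self] at r2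
    refine ((RunsIn.iter_step r1 (RunsIn.iter_step r2 r3))).congr ?_ ?_
    · simp [mul_add]; congr 1; omega
    · simp; omega

variable (K) {B : GateBasis}

/-- Evaluate a gate from its record and store its value. -/
noncomputable def evalGate (B : GateBasis) : Prog S Unit :=
  (readNum K.enc K.scratch).bind fun _ => (readFin K.enc B.numOps).bind fun o =>
    match o with
    | none => pure ()
    | some o => (readWires K (B.arity o)).bind fun y => (rewind K.scratch).bind fun _ =>
      (moveWord K.scratch K.valAddr).bind fun _ => (store K.val (some (B.op o y))).bind fun _ =>
        eraseWord K.valAddr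

/-- Evaluate a circuit from its encoding. -/
noncomputable def evalCircuit (B : GateBasis) : Prog S Bool :=
  iter (fun _ : Unit => (readBit K.enc id).bind fun g =>
    if g then (evalGate K B).bind fun _ => pure (.inl ())
    else (readWire K).bind fun b => pure (.inr b)) ()

/-- The tape with the values of the first `j` gates. -/
def _root_.Circuit.valTape (C : Circuit B n) (x : Fin n → Bool) (j : ℕ) : ℕ → Option Bool :=
  fun i => if h : i < j ∧ i < C.size then some (C.gateVal x i h.2) else none

theorem _root_.Circuit.valTape_succ (C : Circuit B n) (x : Fin n → Bool) (j : Fin C.size) :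
    Function.update (C.valTape x j) j (some (C.gateVal x j j.2)) = C.valTape x (j + 1) := by
  ext1 i
  rcases eq_or_ne i j with rfl | h
  · simp [Circuit.valTape]
  · rw [Function.update_of_ne h]
    simp only [Circuit.valTape]
    have : i < j ∧ i < C.size ↔ i < j + 1 ∧ i < C.size := by omega
    simp only [this]

theorem _root_.Circuit.gateVal_eq (C : Circuit B n) (x : Fin n → Bool) (j : Fin C.size) :
    C.gateVal x j j.2 = B.op (C.gate j) fun a =>
      Sum.elim x (fun i : Fin j => C.gateVal x i (i.2.trans j.2)) (C.arg j a) := by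
  rw [Circuit.gateVal]
  congr 1
  funext a
  cases h : C.arg j a <;> simp

variable {K}

/-- The gate number comes before the arguments, whose lookups need the address tape of the values;
so it waits on the scratch tape. Its word is erased as it moves to the address tape, and the next
scratch word starts further right, whence the new offset `q'`. -/
theorem runsIn_evalGate {C : Circuit B n} {j : Fin C.size}
    (h : K.Inv s c p q [] x (C.valTape x j)) (hw : WordAt c p (C.encGate j)) :
    ∃ s' q', K.Inv s' c (p + (C.encGate j).length) q' [] x (C.valTape x (j + 1)) ∧
      RunsIn (evalGate K B) s () s' (20 * (C.encGate j).length) := by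
  rw [Circuit.encGate] at hw ⊢
  obtain ⟨hw, hw3⟩ := wordAt_append.1 hw
  obtain ⟨hw1, hw2⟩ := wordAt_append.1 hw
  obtain ⟨rfl, rfl, h3, h4, h5, h6, h7, h8, h9, h10, h11⟩ := h
  simp only [List.length_append] at hw3 ⊢
  set L := Nat.bits j with hL
  set p := s.pos K.enc with hp
  set c := s.work K.enc with hc
  have r1 := runsIn_readNum (w := K.enc) (w' := K.scratch) (q := q) (by simp) hw1 (by simpa using h5)
    (by simpa using h4)
  rw [← hL, ← hp, ← hc] at r1
  set s1 := (s.putWork K.enc (p + (encNat j).length) c).putWork K.scratch (q + L.length)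
    (wordTape q L) with hs1
  have e1 : s1.work K.enc = c := by simp [hs1, Store.putWork_work_ne]
  have e1' : s1.pos K.enc = p + (encNat j).length := by simp [hs1, Store.putWork_pos_ne]
  have r2 := runsIn_readFin (s := s1) (w := K.enc) (o := C.gate j) (by rwa [e1, e1'])
  rw [e1, e1'] at r2
  set s2 := s1.putWork K.enc (p + (encNat j).length + (encNat (C.gate j)).length) c with hs2
  have i2 : K.Inv s2 c (p + ((encNat j).length + (encNat (C.gate j)).length)) q L x
      (C.valTape x j) := by
    constructor <;>
      simp [hs2, hs1, Store.putWork_work_ne, Store.putWork_pos_ne, h3, h6, h7, h8, h9, h10, h11,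
        add_assoc]
  have r3 := runsIn_readWires (y := fun i : Fin j => C.gateVal x i (i.2.trans j.2))
    (fun i => by simp [Circuit.valTape, i.2.trans j.2]) i2 hw3
  have i3 := i2.putEnc (p + ((encNat j).length + (encNat (C.gate j)).length) +
    (List.ofFn fun a => encWire (C.arg j a)).flatten.length)
  set s3 := s2.putWork K.enc (p + ((encNat j).length + (encNat (C.gate j)).length) +
    (List.ofFn fun a => encWire (C.arg j a)).flatten.length) c with hs3
  have r4 := runsIn_rewind i3.one_le i3.scratch_pos i3.scratch_work
  set s4 := s3.putWork K.scratch q (s3.work K.scratch) with hs4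
  have r5 := runsIn_moveWord (w := K.scratch) (w' := K.valAddr) (by simp) L [] 0 s4
    (by simp [hs4, i3.scratch_work]) (by simp [hs4, i3.valAddr_pos, Store.putWork_pos_ne])
    (by simp [hs4, i3.valAddr_work, Store.putWork_work_ne])
  set s5 := (s4.putWork K.scratch (s4.pos K.scratch + L.length) fun _ => none).putWork K.valAddr
    (0 + ([] ++ L).length) (wordTape 0 ([] ++ L)) with hs5
  have r6 := runsIn_store K.val (some (C.gateVal x j j.2)) s5
  have e6 : Function.update (s5.mem K.val) (s5.active K.val) (some (C.gateVal x j j.2)) =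
      C.valTape x (j + 1) := by
    rw [← C.valTape_succ]
    simp [hs5, hs4, Store.active, i3.val_mem, hL]
  rw [e6] at r6
  set s6 := s5.putMem K.val (C.valTape x (j + 1)) with hs6
  have r7 := runsIn_eraseWord (s := s6) (w := K.valAddr) (l := L) (by simp [hs6, hs5])
    (by simp [hs6, hs5])
  rw [C.gateVal_eq] at r6
  refine ⟨_, s4.pos K.scratch + L.length, ?_, (r1.bind (r2.bind (a := some (C.gate j)) (r3.bind
    (r4.bind (r5.bind (r6.bind r7)))))).mono ?_⟩
  · have := i3.one_le
    constructor <;> simp [hs6, hs5, hs4, Store.putWork_work_ne, Store.putWork_pos_ne, i3.enc_work,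
      i3.enc_pos, i3.inAddr_work, i3.inAddr_pos, i3.inp_mem, Store.putMem_mem_ne, add_assoc]
    omega
  · have := length_encNat j
    rw [← hL] at this
    omega

/-- The loop invariant: before record `j` the value tape holds exactly the first `j` gate values,
which include all arguments of gate `j` by the topological order. -/
theorem runsIn_evalCircuit {C : Circuit B n} (h : K.Inv s c p q [] x fun _ => none)
    (hw : WordAt c p C.enc) :
    ∃ s', RunsIn (evalCircuit K B) s (C.eval x) s' (24 * C.enc.length) := by
  -- Induction on the number `k` of gates still to be evaluated.
  suffices H : ∀ (k j : ℕ) (s : Store S) (p q : ℕ), j + k = C.size →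
      K.Inv s c p q [] x (C.valTape x j) →
      WordAt c p (((List.ofFn fun j => true :: C.encGate j).drop j).flatten ++
        false :: (encWire C.out ++ encNat n)) →
      ∃ s', RunsIn (evalCircuit K B) s (C.eval x) s'
        (24 * (((List.ofFn fun j => true :: C.encGate j).drop j).flatten ++
        false :: (encWire C.out ++ encNat n)).length) by
    refine H C.size 0 s p q (by simp) ?_ hw
    rwa [show C.valTape x 0 = fun _ => none from funext fun i => by simp [Circuit.valTape]]
  clear h hw
  intro k
  induction k with
  | zero =>
    intro j s p q hj h hw
    rw [List.drop_of_length_le (by simp; omega), List.flatten_nil, List.nil_append] at hw ⊢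
    obtain ⟨h0, hw⟩ := wordAt_cons.1 hw
    obtain ⟨hw, -⟩ := wordAt_append.1 hw
    obtain rfl : j = C.size := by omega
    have r1 := runsIn_readBit (g := id) (w := K.enc) (s := s) (b := false)
      (by rwa [h.enc_work, h.enc_pos])
    rw [h.enc_work, h.enc_pos] at r1
    have r2 := runsIn_readWire (h.putEnc (p + 1)) hw (y := fun i : Fin C.size => C.gateVal x i i.2)
      (fun i => by simp [Circuit.valTape])
    have e : Sum.elim x (fun i : Fin C.size => C.gateVal x i i.2) C.out = C.eval x := by
      rw [Circuit.eval]
      cases C.out <;> rfl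
    rw [e] at r2
    refine ⟨_, RunsIn.iter_exit ((r1.bind (r2.bind (runsIn_pure (Sum.inr (C.eval x)) _))).mono ?_)⟩
    simp only [List.length_cons, List.length_append]
    omega
  | succ k ih =>
    intro j s p q hj h hw
    have hj' : j < C.size := by omega
    rw [List.drop_eq_getElem_cons (by simpa using hj'), List.flatten_cons, List.getElem_ofFn,
      List.cons_append, List.cons_append, List.append_assoc] at hw ⊢
    obtain ⟨h0, hw⟩ := wordAt_cons.1 hw
    obtain ⟨hw1, hw2⟩ := wordAt_append.1 hw
    have r1 := runsIn_readBit (g := id) (w := K.enc) (s := s) (b := true)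
      (by rwa [h.enc_work, h.enc_pos])
    rw [h.enc_work, h.enc_pos] at r1
    obtain ⟨s2, q2, i2, r2⟩ := runsIn_evalGate (j := ⟨j, hj'⟩) (h.putEnc (p + 1)) hw1
    obtain ⟨s3, r3⟩ := ih (j + 1) s2 _ q2 (by omega) i2 hw2
    refine ⟨s3, (RunsIn.iter_step (r1.bind (r2.bind (runsIn_pure (Sum.inl ()) _))) r3).mono ?_⟩
    simp only [List.length_cons, List.length_append, Circuit.encGate, length_encNat]
    omega

end Prog

/-! ### Counters -/

/-- A carry at cell `p`: the digit `1` there is cleared, leaving `b` to be incremented from cell `p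
+ 1` on. -/
theorem update_bitsTape_odd (p b : ℕ) :
    Function.update (bitsTape (2 ^ p * (2 * b + 1))) p none = bitsTape (2 ^ (p + 1) * b) := by
  ext1 i
  rcases eq_or_ne i p with rfl | h
  · simp [bitsTape, Nat.testBit_two_pow_mul]
  · rw [Function.update_of_ne h]
    simp only [bitsTape, Nat.testBit_two_pow_mul]
    rcases lt_or_gt_of_ne h with h1 | h1
    · simp [Nat.not_le.2 h1, Nat.not_le.2 (Nat.lt_succ_of_lt h1)]
    · obtain ⟨j, rfl⟩ := Nat.exists_eq_add_of_lt h1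
      rw [show p + j + 1 - p = j + 1 by omega, show p + j + 1 - (p + 1) = j by omega,
        Nat.testBit_succ, show (2 * b + 1) / 2 = b by omega]
      simp [add_assoc]

theorem update_bitsTape_even (p b : ℕ) :
    Function.update (bitsTape (2 ^ p * (2 * b))) p (some true) =
      bitsTape (2 ^ p * (2 * b + 1)) := by
  ext1 i
  rcases eq_or_ne i p with rfl | h
  · simp [bitsTape, Nat.testBit_two_pow_mul]
  · rw [Function.update_of_ne h]
    simp only [bitsTape, Nat.testBit_two_pow_mul]
    rcases lt_or_gt_of_ne h with h1 | h1
    · simp [Nat.not_le.2 h1]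
    · obtain ⟨j, rfl⟩ := Nat.exists_eq_add_of_lt h1
      rw [show p + j + 1 - p = j + 1 by omega,
        Nat.testBit_succ, Nat.testBit_succ, show (2 * b + 1) / 2 = 2 * b / 2 by omega]

/-- The number of binary digits `1`. -/
def onesCount (a : ℕ) : ℕ := a.bitIndices.length

namespace Prog

variable {S : TapeSig} {w v : S.Work}

/-- Add one to the number on `w`; `v` marks the visited cells of `w`. -/
noncomputable def carry (w v : S.Work) : Prog S Unit :=
  iter (fun _ : Unit => act fun wr mr =>
    if (wr w).isSome then (((Act.noop wr mr).setWork w none .right).setWork v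
      (some ((wr v).getD false)) .right, .inl ())
    else (((Act.noop wr mr).setWork w (some true) .stay).setWork v
      (some ((wr v).getD false)) .stay, .inr ())) ()

/-- Move the heads of `w` and `v` back to cell `0`. -/
noncomputable def home (w v : S.Work) : Prog S Unit :=
  iter (fun _ : Unit => act fun wr mr =>
    if wr v = some true then (Act.noop wr mr, .inr ())
    else (((Act.noop wr mr).setWork w (wr w) .left).setWork v (wr v) .left, .inl ())) ()

/-- Below the head all digits are zero, so the tape holds `2 ^ p * a`. If `a` is even, the carry
ends here; if `a = 2 * b + 1`, it passes to `b` at cell `p + 1`. Each of the `k` carries removes a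
digit `1` and the last write adds one, which gives the balance for `onesCount`. -/
theorem runsIn_carry (hwv : w ≠ v) (a : ℕ) : ∀ (p m : ℕ) (s : Store S), s.pos w = p → s.pos v = p →
    p ≤ m + 1 → s.work w = bitsTape (2 ^ p * a) → s.work v = visited m →
    ∃ k, onesCount (a + 1) + k = onesCount a + 1 ∧
      (∀ i > p + k, bitsTape (2 ^ p * (a + 1)) i = bitsTape (2 ^ p * a) i) ∧
      RunsIn (carry w v) s ()
      ((s.putWork w (p + k) (bitsTape (2 ^ p * (a + 1)))).putWork v (p + k)
        (visited (max m (p + k)))) (2 * k + 1) := by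
  induction a using Nat.strong_induction_on with
  | _ a ih =>
    intro p m s hw hv hp hcw hcv
    rcases Nat.even_or_odd' a with ⟨b, rfl | rfl⟩
    · have hr : s.workRead w = none := by
        simp [Store.workRead, hcw, hw, bitsTape, Nat.testBit_two_pow_mul]
      refine ⟨0, by simp [onesCount], fun i hi => ?_, RunsIn.iter_exit (.act ?_ ?_)⟩
      · rw [← update_bitsTape_even, Function.update_of_ne (by omega)]
      · simp [hr]
      · simp only [hr, Option.isSome_none, Bool.false_eq_true, if_false]
        rw [Store.apply_setWork, Store.apply_setWork, Store.apply_noop]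
        simp [RATM.movePos, hw, hv, hcw, hcv, Store.workRead, update_visited hp,
          update_bitsTape_even]
    · have hr : (s.workRead w).isSome := by
        simp [Store.workRead, hcw, hw, bitsTape, Nat.testBit_two_pow_mul]
      have e : s.apply (((Act.noop s.workRead s.memRead).setWork w none .right).setWork v
          (some ((s.workRead v).getD false)) .right) =
          (s.putWork w (p + 1) (bitsTape (2 ^ (p + 1) * b))).putWork v (p + 1)
            (visited (max m p)) := by
        rw [Store.apply_setWork, Store.apply_setWork, Store.apply_noop]
        simp [RATM.movePos, hw, hv, hcw, hcv, Store.workRead, update_visited hp,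
          update_bitsTape_odd]
      obtain ⟨k, hk, hn, r⟩ := ih b (by omega) (p + 1) (max m p)
        ((s.putWork w (p + 1) (bitsTape (2 ^ (p + 1) * b))).putWork v (p + 1) (visited (max m p)))
        (by simp [Store.putWork_pos_ne _ _ _ hwv]) (by simp) (by omega)
        (by simp [Store.putWork_work_ne _ _ _ hwv]) (by simp)
      refine ⟨k + 1, ?_, fun i hi => ?_, (RunsIn.iter_step (a' := ()) (.act ?_ ?_) r).congr ?_ (by omega)⟩
      · rw [show 2 * b + 1 + 1 = 2 * (b + 1) by ring]
        simp [onesCount] at hk ⊢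
        omega
      · rw [show 2 ^ p * (2 * b + 1 + 1) = 2 ^ (p + 1) * (b + 1) by ring, hn i (by omega),
          ← update_bitsTape_odd, Function.update_of_ne (by omega)]
      · simp [hr]
      · simp only [hr, if_true]; exact e
      · rw [Store.putWork_putWork_putWork_putWork _ hwv, max_assoc,
          max_eq_right (a := p) (by omega), show p + 1 + k = p + (k + 1) by omega,
          show 2 ^ (p + 1) * (b + 1) = 2 ^ p * (2 * b + 1 + 1) by ring]

theorem runsIn_home (hwv : w ≠ v) (p m : ℕ) : ∀ (s : Store S), s.pos w = p → s.pos v = p →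
    s.work v = visited m →
    RunsIn (home w v) s () ((s.putWork w 0 (s.work w)).putWork v 0 (s.work v)) (2 * p + 1) := by
  induction p with
  | zero =>
    intro s hw hv hc
    have hr : s.workRead v = some true := by simp [Store.workRead, hc, hv, visited_eq_true]
    refine RunsIn.iter_exit (.act ?_ ?_)
    · simp [hr]
    · simp only [hr, if_true]
      rw [Store.apply_noop, Store.putWork_eq_self s hw rfl, Store.putWork_eq_self s hv rfl]
  | succ p ih =>
    intro s hw hv hc
    have hr : ¬ s.workRead v = some true := by simp [Store.workRead, hc, hv, visited_eq_true]
    have e : s.apply (((Act.noop s.workRead s.memRead).setWork w (s.workRead w) .left).setWork v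
        (s.workRead v) .left) = (s.putWork w p (s.work w)).putWork v p (s.work v) := by
      rw [Store.apply_setWork, Store.apply_setWork, Store.apply_noop]
      simp [RATM.movePos, hw, hv, Store.workRead]
    refine (RunsIn.iter_step (a' := ()) (.act ?_ ?_) (ih
      ((s.putWork w p (s.work w)).putWork v p (s.work v)) ?_ ?_ ?_)).congr ?_ (by omega)
    · simp [hr]
    · simp only [hr, if_false]; exact e
    · simp [Store.putWork_pos_ne _ _ _ hwv]
    · simp
    · simp [hc]
    · rw [Store.putWork_putWork_putWork_putWork _ hwv]
      simp [Store.putWork_work_ne _ _ _ hwv]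

/-- Add one to the number on `w`, starting and ending with the heads at cell `0`. -/
noncomputable def increment (w v : S.Work) : Prog S Unit := (carry w v).bind fun _ => home w v

/-- With `onesCount` as potential, the cost `4 * k + 3` is constant on average. The statement about
the cells beyond `k` shows that the marks still cover the counter. -/
theorem runsIn_increment (hwv : w ≠ v) {a m : ℕ} {s : Store S} (hw : s.pos w = 0)
    (hv : s.pos v = 0) (hcw : s.work w = bitsTape a) (hcv : s.work v = visited m) :
    ∃ k, onesCount (a + 1) + k = onesCount a + 1 ∧
      (∀ i > k, bitsTape (a + 1) i = bitsTape a i) ∧ RunsIn (increment w v) s ()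
      ((s.putWork w 0 (bitsTape (a + 1))).putWork v 0 (visited (max m k))) (4 * k + 3) := by
  obtain ⟨k, hk, hn, r⟩ := runsIn_carry hwv a 0 m s hw hv (by omega) (by simpa using hcw) hcv
  simp only [Nat.zero_add, pow_zero, one_mul] at hn r
  refine ⟨k, hk, hn, (r.bind (runsIn_home hwv k (max m k) _ ?_ ?_ ?_)).congr ?_ (by omega)⟩
  · simp [Store.putWork_pos_ne _ _ _ hwv]
  · simp
  · simp
  · rw [Store.putWork_putWork_putWork_putWork _ hwv]
    simp [Store.putWork_work_ne _ _ _ hwv]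

/-! ### Erasing a tape of unknown content with the help of its marks -/

/-- Move the heads of `w` and `v` behind the visited cells. -/
noncomputable def toEnd (w v : S.Work) : Prog S Unit :=
  iter (fun _ : Unit => act fun wr mr =>
    if (wr v).isSome then
      (((Act.noop wr mr).setWork w (wr w) .right).setWork v (wr v) .right, .inl ())
    else (Act.noop wr mr, .inr ())) ()

/-- Erase `w` from the heads of `w` and `v` to cell `0`. -/
noncomputable def eraseHome (w v : S.Work) : Prog S Unit :=
  iter (fun _ : Unit => act fun wr mr =>
    if wr v = some true then ((Act.noop wr mr).setWork w none .stay, .inr ())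
    else (((Act.noop wr mr).setWork w none .left).setWork v (wr v) .left, .inl ())) ()

/-- Erase the visited cells of `w`. -/
noncomputable def eraseTape (w v : S.Work) : Prog S Unit :=
  (toEnd w v).bind fun _ => eraseHome w v

theorem runsIn_toEnd (hwv : w ≠ v) {m : ℕ} (k : ℕ) : ∀ (p : ℕ) (s : Store S), p + k = m + 1 →
    s.pos w = p → s.pos v = p → s.work v = visited m →
    RunsIn (toEnd w v) s () ((s.putWork w (m + 1) (s.work w)).putWork v (m + 1) (s.work v))
      (2 * k + 1) := by
  induction k with
  | zero =>
    rintro p s rfl hw hv hc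
    have hr : ¬ (s.workRead v).isSome := by simp [Store.workRead, hc, hv, visited_isSome]
    refine RunsIn.iter_exit (.act ?_ ?_)
    · simp only [hr]; rfl
    · simp only [hr]
      rw [if_neg (by simp), Store.apply_noop, Store.putWork_eq_self s hw rfl,
        Store.putWork_eq_self s hv rfl]
  | succ k ih =>
    intro p s hp hw hv hc
    have hr : (s.workRead v).isSome := by
      simp only [Store.workRead, hc, hv, visited_isSome]; omega
    have e : s.apply (((Act.noop s.workRead s.memRead).setWork w (s.workRead w) .right).setWork v
        (s.workRead v) .right) = (s.putWork w (p + 1) (s.work w)).putWork v (p + 1) (s.work v) := by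
      rw [Store.apply_setWork, Store.apply_setWork, Store.apply_noop]
      simp [RATM.movePos, hw, hv, Store.workRead]
    refine (RunsIn.iter_step (a' := ()) (.act ?_ ?_) (ih (p + 1)
      ((s.putWork w (p + 1) (s.work w)).putWork v (p + 1) (s.work v)) (by omega) ?_ ?_ ?_)).congr
      ?_ (by omega)
    · simp [hr]
    · simp only [hr, if_true]; exact e
    · simp [Store.putWork_pos_ne _ _ _ hwv]
    · simp
    · simp [hc]
    · rw [Store.putWork_putWork_putWork_putWork _ hwv]
      simp [Store.putWork_work_ne _ _ _ hwv]

/-- The invariant is that everything to the right of the head is already blank. -/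
theorem runsIn_eraseHome (hwv : w ≠ v) {m : ℕ} (p : ℕ) : ∀ (s : Store S), s.pos w = p →
    s.pos v = p → s.work v = visited m → (∀ i > p, s.work w i = none) →
    RunsIn (eraseHome w v) s () ((s.putWork w 0 fun _ => none).putWork v 0 (s.work v))
      (2 * p + 1) := by
  have hu : ∀ (p : ℕ) (c : ℕ → Option Bool), (∀ i > p, c i = none) → ∀ i ≥ p,
      Function.update c p none i = none := by
    intro p c h i hi
    rcases eq_or_ne i p with rfl | hne
    · simp
    · rw [Function.update_of_ne hne]; exact h i (by omega)
  induction p with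
  | zero =>
    intro s hw hv hc hn
    have hr : s.workRead v = some true := by simp [Store.workRead, hc, hv, visited_eq_true]
    refine RunsIn.iter_exit (.act ?_ ?_)
    · simp [hr]
    · simp only [hr, if_true]
      rw [Store.apply_setWork, Store.apply_noop, hw,
        show Function.update (s.work w) 0 none = fun _ => none from
          funext fun i => hu 0 _ hn i (Nat.zero_le i),
        Store.putWork_eq_self (s.putWork w _ _) (w := v) (by rw [Store.putWork_pos_ne _ _ _ hwv.symm, hv])
          (by rw [Store.putWork_work_ne _ _ _ hwv.symm])]
      rfl
  | succ p ih =>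
    intro s hw hv hc hn
    have hr : ¬ s.workRead v = some true := by simp [Store.workRead, hc, hv, visited_eq_true]
    have e : s.apply (((Act.noop s.workRead s.memRead).setWork w none .left).setWork v
        (s.workRead v) .left) = (s.putWork w p (Function.update (s.work w) (p + 1) none)).putWork v p
          (s.work v) := by
      rw [Store.apply_setWork, Store.apply_setWork, Store.apply_noop]
      simp [RATM.movePos, hw, hv, Store.workRead]
    refine (RunsIn.iter_step (a' := ()) (.act ?_ ?_) (ih
      ((s.putWork w p (Function.update (s.work w) (p + 1) none)).putWork v p (s.work v))
      ?_ ?_ ?_ ?_)).congr ?_ (by omega)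
    · simp [hr]
    · simp only [hr, if_false]; exact e
    · simp [Store.putWork_pos_ne _ _ _ hwv]
    · simp
    · simp [hc]
    · simpa [Store.putWork_work_ne _ _ _ hwv, Nat.succ_le_iff] using hu (p + 1) _ hn
    · rw [Store.putWork_putWork_putWork_putWork _ hwv]
      simp

theorem runsIn_eraseTape (hwv : w ≠ v) {m p : ℕ} {s : Store S} (hw : s.pos w = p)
    (hv : s.pos v = p) (hp : p ≤ m + 1) (hc : s.work v = visited m)
    (hn : ∀ i > m, s.work w i = none) :
    RunsIn (eraseTape w v) s () ((s.putWork w 0 fun _ => none).putWork v 0 (visited m))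
      (4 * m + 7) := by
  refine ((runsIn_toEnd hwv (m + 1 - p) p s (by omega) hw hv hc).bind
    (runsIn_eraseHome hwv (m := m) (m + 1) _ ?_ ?_ ?_ ?_)).congr ?_ (by omega)
  · simp [Store.putWork_pos_ne _ _ _ hwv]
  · simp
  · simp [hc]
  · intro i hi
    simpa [Store.putWork_work_ne _ _ _ hwv] using hn i (by omega)
  · rw [Store.putWork_putWork_putWork_putWork _ hwv]
    simp [hc]

/-- Copy a word from the random-access tape `r`, with the address tape `w`, to the work tape `e`. -/
noncomputable def copyMem (r : S.Mem) (w v e : S.Work) : Prog S Unit :=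
  iter (fun _ : Unit =>
    Prog.bind (A := Bool) (act fun wr mr =>
      if (mr r).isSome then ((Act.noop wr mr).setWork e (mr r) .right, true)
      else (Act.noop wr mr, false)) fun b =>
      if b then (increment w v).bind fun _ => pure (.inl ()) else pure (.inr ())) ()

/-- The counter equals the number of digits copied, and the first blank cell of `r` ends the loop.
The marks need a bound as well, because the address tape is erased afterwards at a cost linear in
them. -/
theorem runsIn_copyMem {r : S.Mem} {e : S.Work} {q : ℕ} {L : List Bool} (hr : S.addr r = w)
    (hwv : w ≠ v) (hwe : w ≠ e) (hve : v ≠ e) (l : List Bool) :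
    ∀ (l₀ : List Bool) (m : ℕ) (s : Store S), L = l₀ ++ l →
      (∀ i > m, bitsTape l₀.length i = none) → s.mem r = (fun i => L[i]?) →
      s.pos w = 0 → s.pos v = 0 → s.pos e = q + l₀.length → s.work w = bitsTape l₀.length →
      s.work v = visited m → s.work e = wordTape q l₀ →
      -- Both bounds telescope the balance of `runsIn_increment`; the marks grow by at most the
      -- number of carries.
      ∃ m' T, (∀ i > m', bitsTape L.length i = none) ∧ m' + onesCount L.length ≤ m + onesCount l₀.length + l.length ∧
        T + 4 * onesCount L.length ≤ 4 * onesCount l₀.length + 12 * l.length + 4 ∧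
        RunsIn (copyMem r w v e) s () (((s.putWork w 0 (bitsTape L.length)).putWork v 0
          (visited m')).putWork e (q + L.length) (wordTape q L)) T := by
  induction l with
  | nil =>
    intro l₀ m s hL hn hm hpw hpv hpe hw hv he
    rw [List.append_nil] at hL
    subst hL
    have hmr : s.memRead r = none := by
      simp [Store.memRead, Store.active, hr, hw, hm]
    refine ⟨m, 2, hn, by simp, by simp; omega, ?_⟩
    have r1 : RunsIn (S := S) (act fun wr mr =>
      if (mr r).isSome then ((Act.noop wr mr).setWork e (mr r) .right, true)
      else (Act.noop wr mr, false)) s false s 1 := .act (by simp [hmr]) (by simp [hmr])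
    refine (RunsIn.iter_exit (r1.bind (runsIn_pure (Sum.inr ()) s))).congr ?_ (by omega)
    rw [Store.putWork_eq_self s hpw hw, Store.putWork_eq_self s hpv hv,
      Store.putWork_eq_self s hpe he]
  | cons b l ih =>
    intro l₀ m s hL hn hm hpw hpv hpe hw hv he
    have hmr : s.memRead r = some b := by
      simp [Store.memRead, Store.active, hr, hw, hm, hL]
    set s1 := s.putWork e (q + (l₀ ++ [b]).length) (wordTape q (l₀ ++ [b])) with hs1
    have r1 : RunsIn (S := S) (act fun wr mr =>
      if (mr r).isSome then ((Act.noop wr mr).setWork e (mr r) .right, true)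
      else (Act.noop wr mr, false)) s true s1 1 := by
      refine .act ?_ ?_
      · simp [hmr]
      · simp only [hmr, Option.isSome_some, if_true]
        rw [Store.apply_setWork, Store.apply_noop, he, hpe, update_wordTape_append]
        simp [hs1, RATM.movePos, add_assoc]
    obtain ⟨k, hk, hk', r2⟩ := runsIn_increment (s := s1) (a := l₀.length) (m := m) hwv
      (by rw [hs1, Store.putWork_pos_ne _ _ _ hwe, hpw])
      (by rw [hs1, Store.putWork_pos_ne _ _ _ hve, hpv])
      (by rw [hs1, Store.putWork_work_ne _ _ _ hwe, hw])
      (by rw [hs1, Store.putWork_work_ne _ _ _ hve, hv])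
    obtain ⟨m', T, hn', hm', hT, r3⟩ := ih (l₀ ++ [b]) (max m k)
      ((s1.putWork w 0 (bitsTape (l₀.length + 1))).putWork v 0 (visited (max m k)))
      (by simp [hL]) (fun i hi => by
        rw [List.length_append, List.length_singleton, hk' i (by omega), hn i (by omega)])
      (by simp [hs1, hm]) (by simp [Store.putWork_pos_ne _ _ _ hwv]) (by simp)
      (by simp [hs1, Store.putWork_pos_ne _ _ _ hve.symm, Store.putWork_pos_ne _ _ _ hwe.symm])
      (by simp [Store.putWork_work_ne _ _ _ hwv]) (by simp)
      (by simp [hs1, Store.putWork_work_ne _ _ _ hve.symm, Store.putWork_work_ne _ _ _ hwe.symm])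
    simp only [List.length_append, List.length_cons, List.length_nil, zero_add] at hm' hT ⊢
    refine ⟨m', 4 * k + 8 + T, hn', by omega, by omega, ?_⟩
    refine (RunsIn.iter_step (r1.bind (r2.bind (runsIn_pure (Sum.inl ()) _))) r3).congr ?_ ?_
    · rw [Store.putWork_putWork_putWork_putWork _ hwv, hs1]
      rw [Store.putWork_comm _ _ _ _ _ hwe.symm, Store.putWork_comm _ _ _ _ _ hve.symm,
        Store.putWork_putWork]
    · omega

end Prog

/-! ### Global uniformity -/

open Classical in
/-- The store with the word `l` on the random-access tape `r`, everything else being blank. -/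
noncomputable def Store.init {S : TapeSig} (r : S.Mem) (l : List Bool) : Store S where
  pos := fun _ => 0
  work := fun _ _ => none
  mem := fun r' i => if r' = r then l[i]? else none

/-- The tapes of `M`, a tape of marks for each of its work tapes, and further tapes; the input
tape `inr 0` and the flags `inr 1` share their address tape with the tape `inp` of `M`. -/
def simSig (M : RATM) (inp : M.Mem) : TapeSig :=
  letI := M.finWork
  letI := M.finMem
  { Work := (M.Work × Bool) ⊕ Fin 3
    Mem := M.Mem ⊕ Fin 3
    addr := fun r => match r with
      | .inl r => .inl (M.addr r, false)
      | .inr i => if i = 2 then .inr 2 else .inl (M.addr inp, false) }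

/-! ### Running the generator as if its input were `1ⁿ` -/

namespace Simulation

variable {M : RATM} {inp : M.Mem}

def tape (w : M.Work) : (simSig M inp).Work := .inl (w, false)
def marks (w : M.Work) : (simSig M inp).Work := .inl (w, true)
def extra (i : Fin 3) : (simSig M inp).Work := .inr i
def mem (r : M.Mem) : (simSig M inp).Mem := .inl r
def extraMem (i : Fin 3) : (simSig M inp).Mem := .inr i

@[simp] theorem tape_ne_marks (w w' : M.Work) : tape (inp := inp) w ≠ marks w' :=
  fun h => by cases h
@[simp] theorem marks_ne_tape (w w' : M.Work) : marks (inp := inp) w ≠ tape w' :=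
  fun h => by cases h
@[simp] theorem tape_ne_extra (w : M.Work) (i : Fin 3) : tape (inp := inp) w ≠ extra i :=
  fun h => by cases h
@[simp] theorem extra_ne_tape (w : M.Work) (i : Fin 3) : extra (inp := inp) i ≠ tape w :=
  fun h => by cases h
@[simp] theorem marks_ne_extra (w : M.Work) (i : Fin 3) : marks (inp := inp) w ≠ extra i :=
  fun h => by cases h
@[simp] theorem extra_ne_marks (w : M.Work) (i : Fin 3) : extra (inp := inp) i ≠ marks w :=
  fun h => by cases h
@[simp] theorem extra_inj (i j : Fin 3) : extra (inp := inp) i = extra j ↔ i = j :=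
  ⟨fun h => by cases h; rfl, fun h => h ▸ rfl⟩
@[simp] theorem tape_inj (w w' : M.Work) : tape (inp := inp) w = tape w' ↔ w = w' :=
  ⟨fun h => by cases h; rfl, fun h => h ▸ rfl⟩
@[simp] theorem marks_inj (w w' : M.Work) : marks (inp := inp) w = marks w' ↔ w = w' :=
  ⟨fun h => by cases h; rfl, fun h => h ▸ rfl⟩
@[simp] theorem addr_mem (r : M.Mem) : (simSig M inp).addr (mem r) = tape (M.addr r) := rfl

/-- What the simulated machine reads on its random-access tapes: the cells of `inp` without a flag
hold `1` wherever the input tape is not blank. -/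
noncomputable def virtualRead (mr : (simSig M inp).Mem → Option Bool) : M.Mem → Option Bool :=
  open Classical in fun r =>
    if r = inp ∧ mr (extraMem 1) = none then (mr (extraMem 0)).map fun _ => true else mr (mem r)

/-- Simulate `M` on the input `1ⁿ`, given any word of length `n` on the input tape. -/
noncomputable def simulate (M : RATM) (inp : M.Mem) : Prog (simSig M inp) Unit :=
  letI := M.finState
  { State := M.State
    start := M.start
    δ := fun q wr mr => match M.δ q (fun w => wr (tape w)) (virtualRead mr) with
      | none => .inr ()
      | some (q', a, b) => .inl (q',
          fun u => match u with
            | .inl (w, false) => a w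
            | .inl (w, true) => (some ((wr (marks w)).getD false), (a w).2)
            | .inr i => (wr (extra i), .stay),
          fun r => match r with
            | .inl r => b r
            | .inr i => if i = 1 then some true else mr (extraMem i)) }

/-- The marks of `w` cover its cells that are not blank, up to cell `n` at most. -/
def Covered (s : Store (simSig M inp)) (n : ℕ) (w : M.Work) : Prop :=
  ∃ m ≤ n, s.pos (marks w) = s.pos (tape w) ∧ s.pos (tape w) ≤ m + 1 ∧
    s.work (marks w) = visited m ∧ ∀ i > m, s.work (tape w) i = none

/-- After `n` steps, the store `s` represents the configuration `c` of `M` on the input `1ⁿ`, and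
`out` has at most `n` cells that are not blank. -/
structure Rel (out : M.Mem) (x : ℕ → Option Bool) (n : ℕ) (c : M.Cfg) (q : M.State)
    (s : Store (simSig M inp)) : Prop where
  state : q = c.state
  pos : ∀ w, s.pos (tape w) = c.pos w
  work : ∀ w, s.work (tape w) = c.work w
  covered : ∀ w, Covered s n w
  mem : ∀ r i, c.mem r i = open Classical in
    if r = inp ∧ s.mem (extraMem 1) i = none then (s.mem (extraMem 0) i).map fun _ => true
      else s.mem (mem r) i
  input : s.mem (extraMem 0) = x
  val_blank : s.mem (extraMem 2) = fun _ => none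
  extra_pos : ∀ i, s.pos (extra i) = 0
  extra_work : ∀ i, s.work (extra i) = fun _ => none
  out_card : ∃ F : Finset ℕ, F.card ≤ n ∧ ∀ i ∉ F, c.mem out i = none

/-- The tapes `inp`, `x` and the flags share an address tape, so one step sees the same cell of all
three. -/
theorem Rel.virtualRead_eq {out : M.Mem} {x : ℕ → Option Bool} {n : ℕ} {c : M.Cfg} {q : M.State}
    {s : Store (simSig M inp)} (h : Rel out x n c q s) :
    virtualRead s.memRead = fun r => c.mem r (c.active r) := by
  funext r
  rw [h.mem]
  have e : ∀ r, s.active (Simulation.mem r) = c.active r := fun r => by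
    simp [Store.active, h.work, RATM.Cfg.active]
  have e' : ∀ r, s.memRead (Simulation.mem r) = s.mem (Simulation.mem r) (c.active r) := fun r =>
    congrArg _ (e r)
  have e0 : s.memRead (extraMem 0) = s.mem (extraMem 0) (c.active inp) := congrArg _ (e inp)
  have e1 : s.memRead (extraMem 1) = s.mem (extraMem 1) (c.active inp) := congrArg _ (e inp)
  simp only [virtualRead, e', e0, e1]
  by_cases hr : r = inp
  · subst hr
    by_cases hf : s.memRead (extraMem 1) = none
    · rw [if_pos ⟨rfl, hf⟩, if_pos ⟨rfl, e1 ▸ hf⟩]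
    · rw [if_neg fun h => hf h.2, if_neg fun h => hf (e1.trans h.2)]
  · simp [hr]

theorem runsIn_simulate {out : M.Mem} {x : ℕ → Option Bool} {c c' : M.Cfg} {T : ℕ}
    (h : RATM.HaltsWithin c c' T) {s : Store (simSig M inp)} (h₀ : Rel out x 0 c M.start s) :
    ∃ n ≤ T, ∃ q s', Rel out x n c' q s' ∧ (simulate M inp).RunsIn s () s' T := by
  have key := h.runsIn (p := simulate M inp) (Rel out x) h₀ ?_ ?_
  · obtain ⟨r, n, q, s', hn, hR, hr⟩ := key
    exact ⟨n, hn, q, s', hR, hr⟩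
  · intro n c c' q s hR hs
    have hw : (fun w => s.workRead (tape w)) = fun w => c.work w (c.pos w) := by
      funext w; simp [Store.workRead, hR.pos, hR.work]
    have hv := hR.virtualRead_eq
    obtain ⟨⟨q', a, b⟩, hδ, rfl⟩ := Option.map_eq_some_iff.1 hs
    have hδ' : M.δ q (fun w => s.workRead (tape w)) (virtualRead s.memRead) = some (q', a, b) := by
      rw [hw, hv, hR.state, hδ]
    refine ⟨q', _, by simp only [simulate, hδ']; rfl, ?_⟩
    have e : ∀ r, s.active (Simulation.mem r) = c.active r := fun r => by
      simp [Store.active, hR.work, RATM.Cfg.active]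
    have e0 : s.active (extraMem 0) = c.active inp := e inp
    have e1 : s.active (extraMem 1) = c.active inp := e inp
    constructor
    · rfl
    · intro w
      change RATM.movePos (a w).2 (s.pos (tape w)) = _
      rw [hR.pos]
    · intro w
      change Function.update (s.work (tape w)) (s.pos (tape w)) (a w).1 = _
      rw [hR.pos, hR.work]
    · intro w
      obtain ⟨m, hm, h1, h2, h3, h4⟩ := hR.covered w
      refine ⟨max m (s.pos (tape w)), by omega, ?_, ?_, ?_, ?_⟩
      · change RATM.movePos (a w).2 (s.pos (marks w)) = RATM.movePos (a w).2 (s.pos (tape w))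
        rw [h1]
      · change RATM.movePos (a w).2 (s.pos (tape w)) ≤ _
        cases (a w).2 <;> simp only [RATM.movePos] <;> omega
      · change Function.update (s.work (marks w)) (s.pos (marks w))
          (some ((s.work (marks w) (s.pos (marks w))).getD false)) = _
        rw [h3, h1, update_visited h2]
      · intro i hi
        change Function.update (s.work (tape w)) (s.pos (tape w)) (a w).1 i = none
        rw [Function.update_of_ne (by omega), h4 i (by omega)]
    · intro r i
      change Function.update (c.mem r) (c.active r) (b r) i = _
      change _ = open Classical in
        if r = inp ∧ Function.update (s.mem (extraMem 1)) (s.active (extraMem 1)) (some true) i = none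
        then (Function.update (s.mem (extraMem 0)) (s.active (extraMem 0))
          (s.mem (extraMem 0) (s.active (extraMem 0))) i).map fun _ => true
        else Function.update (s.mem (mem r)) (s.active (Simulation.mem r)) (b r) i
      rw [e, e0, e1, Function.update_eq_self]
      -- A step rewrites the scanned cell of `inp` and flags it, so this cell is read from `mem inp`
      -- from now on; the other cells keep their flags.
      by_cases hi : i = c.active r
      · subst hi
        rw [Function.update_self, Function.update_self, if_neg]
        rintro ⟨rfl, h⟩
        simp at h
      · rw [Function.update_of_ne hi, Function.update_of_ne hi, hR.mem]
        by_cases hr : r = inp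
        · subst hr; rw [Function.update_of_ne hi]
        · simp [hr]
    · change Function.update (s.mem (extraMem 0)) (s.active (extraMem 0))
          (s.mem (extraMem 0) (s.active (extraMem 0))) = _
      rw [Function.update_eq_self, hR.input]
    · change Function.update (s.mem (extraMem 2)) (s.active (extraMem 2))
          (s.mem (extraMem 2) (s.active (extraMem 2))) = _
      rw [Function.update_eq_self, hR.val_blank]
    · exact hR.extra_pos
    · intro i
      change Function.update (s.work (extra i)) (s.pos (extra i))
          (s.work (extra i) (s.pos (extra i))) = _
      rw [Function.update_eq_self, hR.extra_work]
    -- A step can change only the scanned cell of `out`.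
    · obtain ⟨F, hF, hF'⟩ := hR.out_card
      refine ⟨insert (c.active out) F, (Finset.card_insert_le _ _).trans (by omega),
        fun i hi => ?_⟩
      rw [Finset.mem_insert, not_or] at hi
      exact (Function.update_of_ne hi.1 _ _).trans (hF' i hi.2)
  · intro n c q s hR hs
    have hw : (fun w => s.workRead (tape w)) = fun w => c.work w (c.pos w) := by
      funext w; simp [Store.workRead, hR.pos, hR.work]
    have hδ : M.δ q (fun w => s.workRead (tape w)) (virtualRead s.memRead) = none := by
      rw [hw, hR.virtualRead_eq, hR.state]
      exact Option.map_eq_none_iff.1 hs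
    exact ⟨(), by simp only [simulate, hδ]⟩

/-- Mark cell `0` of all work tapes of `M`. -/
noncomputable def mark (M : RATM) (inp : M.Mem) : Prog (simSig M inp) Unit :=
  Prog.act fun wr mr => ((fun u => match u with
    | .inl (_, true) => (some true, .stay)
    | .inl (w, false) => (wr (tape w), .stay)
    | .inr i => (wr (extra i), .stay), mr), ())

/-- With no flag set, the word `l` already looks like `1ⁿ` for its length `n`, so only the marks
need initializing, which takes one step. By `ho` the output tape of `M` starts blank. -/
theorem runsIn_mark {out : M.Mem} (ho : inp ≠ out) (l : List Bool) :
    ∃ s', Rel out (fun i => l[i]?) 0 (RATM.cfgOf M.start inp (List.replicate l.length true))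
        M.start s' ∧
      (mark M inp).RunsIn (Store.init (S := simSig M inp) (extraMem 0) l) () s' 1 := by
  set s := Store.init (S := simSig M inp) (extraMem 0) l with hs
  refine ⟨_, ?_, Prog.runsIn_act _ _⟩
  have h0 : ∀ r, s.mem (mem r) = fun _ => none := fun r => by
    simp [hs, Store.init, mem, extraMem]
  have h1 : s.mem (extraMem 1) = fun _ => none :=
    funext fun i => if_neg fun h => absurd (Sum.inr.inj h) (by decide)
  have h2 : s.mem (extraMem 2) = fun _ => none :=
    funext fun i => if_neg fun h => absurd (Sum.inr.inj h) (by decide)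
  have h3 : s.mem (extraMem 0) = fun i => l[i]? := by simp [hs, Store.init]
  have hm : ∀ r i, (Function.update (s.mem r) (s.active r) (s.memRead r)) i = s.mem r i :=
    fun r i => by simp [Store.memRead]
  constructor
  · rfl
  · exact fun w => rfl
  · intro w
    exact Function.update_eq_self_iff.2 rfl
  · refine fun w => ⟨0, le_rfl, rfl, Nat.zero_le _, ?_, fun i hi => ?_⟩
    · change Function.update (fun _ => none) 0 (some true) = _
      funext i
      cases i <;> simp [visited]
    · exact (Function.update_of_ne (Nat.pos_iff_ne_zero.1 hi) _ _)
  · intro r i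
    change (open Classical in if r = inp then (List.replicate l.length true)[i]? else none) =
      open Classical in if r = inp ∧ Function.update (s.mem (extraMem 1)) (s.active (extraMem 1))
        (s.memRead (extraMem 1)) i = none
      then (Function.update (s.mem (extraMem 0)) (s.active (extraMem 0))
          (s.memRead (extraMem 0)) i).map fun _ => true
        else Function.update (s.mem (mem r)) (s.active (Simulation.mem r)) (s.memRead (mem r)) i
    rw [hm, hm, hm, h0, h1, h3]
    by_cases hr : r = inp
    · simp only [hr, if_true, and_self]
      rw [List.getElem?_replicate]
      split_ifs with h
      · simp [h]
      · simp [not_lt.1 h]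
    · simp [hr]
  · funext i; exact (hm _ i).trans (by rw [h3])
  · funext i; exact (hm _ i).trans (by rw [h2])
  · exact fun i => rfl
  · intro i
    exact Function.update_eq_self_iff.2 rfl
  · exact ⟨∅, by simp, fun i _ => by simp [RATM.cfgOf, ho.symm]⟩

end Simulation

/-! ### From the generated encoding to the evaluation tapes -/

namespace Simulation

variable {M : RATM} {inp : M.Mem} {s : Store (simSig M inp)}

/-- The tape of `w` is blank and its head is at cell `0`. -/
def Blank (s : Store (simSig M inp)) (w : M.Work) : Prop :=
  s.pos (tape w) = 0 ∧ s.work (tape w) = fun _ => none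

/-- Coverage and blankness are preserved for every tape, `w` included, because the two address tapes
that are erased in succession may coincide. -/
theorem runsIn_erase {n : ℕ} {w : M.Work} (h : Covered s n w) :
    ∃ s', (Prog.eraseTape (tape w) (marks w)).RunsIn s () s' (4 * n + 7) ∧
      (∀ w', Covered s n w' → Covered s' n w') ∧ s'.mem = s.mem ∧
      (∀ i, s'.pos (extra i) = s.pos (extra i)) ∧ (∀ i, s'.work (extra i) = s.work (extra i)) ∧
      Blank s' w ∧ ∀ w', Blank s w' → Blank s' w' := by
  obtain ⟨m, hm, h1, h2, h3, h4⟩ := h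
  refine ⟨_, (Prog.runsIn_eraseTape (by simp) rfl h1 h2 h3 h4).mono (by omega), ?_, rfl, ?_, ?_, ?_,
    ?_⟩
  · intro w' h'
    by_cases hw : w' = w
    · subst hw
      exact ⟨m, hm, by simp [Store.putWork_pos_ne], by simp [Store.putWork_pos_ne], by simp,
        fun i _ => by simp [Store.putWork_work_ne]⟩
    · simpa [Covered, Store.putWork_pos_ne, Store.putWork_work_ne, hw] using h'
  · intro i; simp [Store.putWork_pos_ne]
  · intro i; simp [Store.putWork_work_ne]
  · simp [Blank, Store.putWork_pos_ne, Store.putWork_work_ne]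
  · intro w' h'
    by_cases hw : w' = w
    · subst hw; simp [Blank, Store.putWork_pos_ne, Store.putWork_work_ne]
    · simpa [Blank, Store.putWork_pos_ne, Store.putWork_work_ne, hw] using h'

/-- The tapes for the evaluation of the circuit that has been generated. -/
def evalTapes (M : RATM) (inp : M.Mem) : EvalTapes (simSig M inp) where
  enc := extra 0
  scratch := extra 1
  inAddr := tape (M.addr inp)
  valAddr := extra 2
  inp := extraMem 0
  val := extraMem 2
  addr_inp := rfl
  addr_val := rfl
  inp_ne_val := fun h => absurd (Sum.inr.inj h) (by decide)
  enc_ne_scratch := by simp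
  enc_ne_inAddr := by simp
  enc_ne_valAddr := by simp
  scratch_ne_inAddr := by simp
  scratch_ne_valAddr := by simp
  inAddr_ne_valAddr := by simp

/-- Copy the word on the tape `out` of `M` to the tape that the evaluation reads. -/
noncomputable def loadEncoding (M : RATM) (inp out : M.Mem) : Prog (simSig M inp) Unit :=
  (Prog.eraseTape (tape (M.addr inp)) (marks (M.addr inp))).bind fun _ =>
  (Prog.eraseTape (tape (M.addr out)) (marks (M.addr out))).bind fun _ =>
  (Prog.move (extra 0) .right).bind fun _ => (Prog.move (extra 1) .right).bind fun _ =>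
  (Prog.copyMem (mem out) (tape (M.addr out)) (marks (M.addr out)) (extra 0)).bind fun _ =>
  (Prog.rewind (extra 0)).bind fun _ =>
  Prog.eraseTape (tape (M.addr out)) (marks (M.addr out))

/-- The bound `L.length ≤ n` is what makes the length of the encoding, and so the evaluation time,
at most a constant times the time of the generator. -/
theorem runsIn_loadEncoding {out : M.Mem} (ho : inp ≠ out) {k n : ℕ} {x : Fin k → Bool} {c : M.Cfg}
    {q : M.State} {L : List Bool} (h : Rel out (fun i => (List.ofFn x)[i]?) n c q s)
    (hc : c.mem out = fun i => L[i]?) :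
    L.length ≤ n ∧ ∃ s', (loadEncoding M inp out).RunsIn s () s' (12 * n + 18 * L.length + 50) ∧
      (evalTapes M inp).Inv s' (wordTape 1 L) 1 1 [] x fun _ => none := by
  constructor
  -- The cells below `L.length` are not blank, hence all lie in `F`.
  · obtain ⟨F, hF, hF'⟩ := h.out_card
    have : Finset.range L.length ⊆ F := by
      intro i hi
      by_contra hn
      have := hF' i hn
      rw [hc] at this
      simp at this hi
      omega
    simpa using (Finset.card_le_card this).trans hF
  obtain ⟨s1, r1, c1, m1, p1, w1, b1, -⟩ := runsIn_erase (h.covered (M.addr inp))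
  obtain ⟨s2, r2, c2, m2, p2, w2, b2, b2'⟩ := runsIn_erase (c1 _ (h.covered (M.addr out)))
  have r3 := Prog.runsIn_move (extra 0) .right s2
  have hp0 : s2.pos (extra 0) = 0 := by rw [p2, p1, h.extra_pos]
  have hp1 : s2.pos (extra 1) = 0 := by rw [p2, p1, h.extra_pos]
  have hp2 : s2.pos (extra 2) = 0 := by rw [p2, p1, h.extra_pos]
  have hw0 : s2.work (extra 0) = fun _ => none := by rw [w2, w1, h.extra_work]
  have hw1 : s2.work (extra 1) = fun _ => none := by rw [w2, w1, h.extra_work]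
  have hw2 : s2.work (extra 2) = fun _ => none := by rw [w2, w1, h.extra_work]
  rw [hp0, hw0] at r3
  set s3 := s2.putWork (extra 0) (RATM.movePos .right 0) fun _ => none with hs3
  have r4 := Prog.runsIn_move (extra 1) .right s3
  rw [show s3.pos (extra 1) = 0 by simp [hs3, Store.putWork_pos_ne, hp1],
    show s3.work (extra 1) = fun _ => none by simp [hs3, Store.putWork_work_ne, hw1]] at r4
  set s4 := s3.putWork (extra 1) (RATM.movePos .right 0) fun _ => none with hs4
  obtain ⟨m, hm, hm1, hm2, hm3, -⟩ := c2 _ (c1 _ (h.covered (M.addr out)))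
  have hb : s4.pos (tape (M.addr out)) = 0 ∧ s4.work (tape (M.addr out)) = fun _ => none := by
    simpa [hs4, hs3, Store.putWork_pos_ne, Store.putWork_work_ne, Blank] using b2
  have hout : s.mem (mem out) = fun i => L[i]? := by
    funext i
    have := h.mem out i
    rw [hc, if_neg fun h => ho h.1.symm] at this
    exact this.symm
  obtain ⟨m', T, hn', hm', hT, r5⟩ := Prog.runsIn_copyMem (r := mem out) (w := tape (M.addr out))
    (v := marks (M.addr out)) (e := extra 0) (q := 1) (L := L) rfl (by simp) (by simp) (by simp)
    L [] m s4 rfl (by simp) (by rw [← hout, ← m1, ← m2]; rfl) hb.1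
    (by rw [← hb.1]; simpa [hs4, hs3, Store.putWork_pos_ne] using hm1)
    (by simp [hs4, hs3, Store.putWork_pos_ne, RATM.movePos]) (by simpa using hb.2)
    (by simpa [hs4, hs3, Store.putWork_work_ne] using hm3)
    (by simp [hs4, hs3, Store.putWork_work_ne])
  set s5 := ((s4.putWork (tape (M.addr out)) 0 (bitsTape L.length)).putWork
    (marks (M.addr out)) 0 (visited m')).putWork (extra 0) (1 + L.length) (wordTape 1 L) with hs5
  have r6 := Prog.runsIn_rewind (s := s5) (w := extra 0) (p := 1) (l := L) le_rfl
    (by simp [hs5]) (by simp [hs5])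
  set s6 := s5.putWork (extra 0) 1 (s5.work (extra 0)) with hs6
  have c6 : Covered s6 m' (M.addr out) := by
    refine ⟨m', le_rfl, ?_, ?_, ?_, fun i hi => ?_⟩
    · simp [hs6, hs5, Store.putWork_pos_ne]
    · simp [hs6, hs5, Store.putWork_pos_ne]
    · simp [hs6, hs5, Store.putWork_work_ne]
    · simpa [hs6, hs5, Store.putWork_work_ne] using hn' i hi
  obtain ⟨s7, r7, -, m7, p7, w7, b7, b7'⟩ := runsIn_erase c6
  refine ⟨s7, (r1.bind (r2.bind (r3.bind (r4.bind (r5.bind (r6.bind r7)))))).mono ?_, ?_⟩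
  · have h0 : onesCount ([] : List Bool).length = 0 := by simp [onesCount]
    rw [h0] at hm' hT
    omega
  · have hb7 : Blank s7 (M.addr inp) := by
      -- `M` may use one address tape for both; this is also why the counter is erased after
      -- copying.
      by_cases he : M.addr inp = M.addr out
      · rw [he]; exact b7
      · refine b7' _ ?_
        simpa [Blank, hs6, hs5, hs4, hs3, Store.putWork_pos_ne, Store.putWork_work_ne, he]
          using b2' _ b1
    have hmem : s7.mem = s.mem := by
      rw [m7, ← m1, ← m2]; rfl
    constructor
    · change s7.work (extra 0) = _
      rw [w7]; simp [hs6, hs5]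
    · change s7.pos (extra 0) = _
      rw [p7]; simp [hs6]
    · exact le_rfl
    · change s7.work (extra 1) = _
      rw [w7]; simp [hs6, hs5, hs4, Store.putWork_work_ne]
    · change s7.pos (extra 1) = _
      rw [p7]; simp [hs6, hs5, hs4, Store.putWork_pos_ne, RATM.movePos]
    · exact hb7.2
    · exact hb7.1
    · change s7.work (extra 2) = _
      rw [w7]; simp [hs6, hs5, hs4, hs3, Store.putWork_work_ne, hw2]
    · change s7.pos (extra 2) = _
      rw [p7]; simp [hs6, hs5, hs4, hs3, Store.putWork_pos_ne, hp2]
    · rw [hmem]; exact h.input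
    · rw [hmem]; exact h.val_blank

/-- Generate the encoding of a circuit with `M` and evaluate the circuit on the input. -/
noncomputable def decider (M : RATM) (inp out : M.Mem) (B : GateBasis) :
    Prog (simSig M inp) Bool :=
  (mark M inp).bind fun _ => (simulate M inp).bind fun _ =>
    (loadEncoding M inp out).bind fun _ => Prog.evalCircuit (evalTapes M inp) B

end Simulation

theorem RATM.HaltsWithin.mono {M : RATM} {c c' : M.Cfg} {T T' : ℕ}
    (h : RATM.HaltsWithin c c' T) (hT : T ≤ T') : RATM.HaltsWithin c c' T' :=
  let ⟨s, hs, h⟩ := h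
  ⟨s, hs.trans hT, h⟩

open Simulation in
-- Marking, simulation, copying and evaluation each take time linear in `τ n` or in the length of
-- the encoding, which is at most `τ n`.
theorem mem_DTIME_of_globallyUniform {B : GateBasis} {T : ℕ+ → ℝ} {C : CircuitFamily B}
    {f : BoolFamily} (hC : ∀ n, (C n).Computes (f n)) (h : GloballyUniform T C) :
    f ∈ DTIME T := by
  obtain ⟨M, inp, out, τ, ho, hτ, hM⟩ := h
  refine ⟨(decider M inp out B).toRATM, extraMem (inp := inp) 0, Sum.elim (fun _ => false) id,
    fun n => 200 * τ n, ?_, fun n x => ?_⟩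
  · simpa using hτ.const_mul_left 200
  · obtain ⟨c, hc, henc⟩ := hM n
    obtain ⟨s1, R1, r1⟩ := runsIn_mark (M := M) ho (List.ofFn x)
    rw [List.length_ofFn] at R1
    obtain ⟨k, hk, q, s2, R2, r2⟩ := runsIn_simulate hc R1
    obtain ⟨hL, s3, r3, i3⟩ := runsIn_loadEncoding ho R2 henc
    obtain ⟨s4, r4⟩ := Prog.runsIn_evalCircuit i3 (wordAt_wordTape _ _)
    -- It follows that `1 ≤ τ n`, so additive constants are absorbed by the factor `200`.
    have hpos : 1 ≤ (C n).enc.length := by simp [Circuit.enc]; omega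
    have r : (decider M inp out B).RunsIn _ _ _ _ := r1.bind (r2.bind (r3.bind r4))
    exact ⟨_, (r.mono (T' := 200 * τ n - 1) (by omega)).haltsWithin.mono (by dsimp only; omega), hC n x⟩

/-! ### Local uniformity -/

namespace Store

variable {S : TapeSig} {s s' : Store S}

theorem putWork_eq {w : S.Work} {p : ℕ} {c : ℕ → Option Bool} (hp : s'.pos w = p)
    (hc : s'.work w = c) (hpos : ∀ u ≠ w, s.pos u = s'.pos u)
    (hwork : ∀ u ≠ w, s.work u = s'.work u) (hmem : s.mem = s'.mem) : s.putWork w p c = s' := by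
  ext u : 2
  · by_cases hu : u = w
    · subst hu; simp [hp]
    · rw [putWork_pos_ne _ _ _ hu, hpos u hu]
  · by_cases hu : u = w
    · subst hu; simp [hc]
    · rw [putWork_work_ne _ _ _ hu, hwork u hu]
  · rw [putWork_mem, hmem]

theorem putMem_eq {r : S.Mem} {c : ℕ → Option Bool} (hc : s'.mem r = c) (hpos : s.pos = s'.pos)
    (hwork : s.work = s'.work) (hmem : ∀ u ≠ r, s.mem u = s'.mem u) : s.putMem r c = s' := by
  ext u : 2
  · rw [putMem_pos, hpos]
  · rw [putMem_work, hwork]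
  · by_cases hu : u = r
    · subst hu; simp [hc]
    · rw [putMem_mem_ne _ _ hu, hmem u hu]

end Store

namespace Prog

variable {S : TapeSig}

/-- Write a fixed word. -/
noncomputable def writeWord (w : S.Work) : List Bool → Prog S Unit
  | [] => pure ()
  | b :: l => (write w (some b) .right).bind fun _ => writeWord w l

theorem runsIn_writeWord (w : S.Work) (l : List Bool) : ∀ (l₀ : List Bool) (s : Store S),
    s.pos w = l₀.length → s.work w = wordTape 0 l₀ →
    RunsIn (writeWord w l) s () (s.putWork w (l₀ ++ l).length (wordTape 0 (l₀ ++ l)))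
      (2 * l.length) := by
  induction l with
  | nil =>
    intro l₀ s hp hc
    refine (runsIn_pure () s).congr ?_ (by simp)
    rw [List.append_nil, Store.putWork_eq_self s hp hc]
  | cons b l ih =>
    intro l₀ s hp hc
    have r1 := runsIn_write w (some b) .right s
    have e := update_wordTape_append 0 l₀ b
    rw [Nat.zero_add] at e
    rw [hp, hc, e] at r1
    refine (r1.bind (ih (l₀ ++ [b]) _ (by simp [RATM.movePos]) (by simp))).congr ?_ ?_
    · simp
    · simp; omega

/-- Write a fixed word on a random-access tape, from cell `i` on. -/
noncomputable def writeMem (r : S.Mem) : ℕ → List Bool → Prog S Unit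
  | _, [] => pure ()
  | i, b :: l => (writeWord (S.addr r) (Nat.bits i)).bind fun _ => (store r (some b)).bind fun _ =>
      (eraseWord (S.addr r)).bind fun _ => writeMem r (i + 1) l

/-- The order of the quantifiers matters: `T` depends on the fixed word and its place only, hence is
a constant when the word is `⟨C 1⟩`. -/
theorem runsIn_writeMem (r : S.Mem) (l : List Bool) : ∀ i : ℕ, ∃ T, ∀ (l₀ : List Bool)
    (s : Store S), l₀.length = i → s.pos (S.addr r) = 0 → s.work (S.addr r) = (fun _ => none) →
    s.mem r = (fun j => l₀[j]?) →
    RunsIn (writeMem r i l) s () (s.putMem r fun j => (l₀ ++ l)[j]?) T := by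
  induction l with
  | nil =>
    refine fun i => ⟨0, fun l₀ s _ _ _ hm => (runsIn_pure () s).congr ?_ le_rfl⟩
    rw [List.append_nil, ← hm]
    simp [Store.putMem]
  | cons b l ih =>
    intro i
    obtain ⟨T, hT⟩ := ih (i + 1)
    refine ⟨2 * (Nat.bits i).length + (1 + (2 * (Nat.bits i).length + 3 + T + 1) + 1) + 1,
      fun l₀ s hl hp hc hm => ?_⟩
    have r1 := runsIn_writeWord (S.addr r) (Nat.bits i) [] s (by simpa) (by simpa)
    have r2 := runsIn_store r (some b) (s.putWork (S.addr r) ([] ++ Nat.bits i).length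
      (wordTape 0 ([] ++ Nat.bits i)))
    have e := update_wordTape_append 0 l₀ b
    rw [wordTape_zero, wordTape_zero, Nat.zero_add, hl, ← hm] at e
    rw [Store.putWork_mem, Store.active, Store.putWork_work_self, List.nil_append,
      number_wordTape_bits, e] at r2
    have r3 := runsIn_eraseWord (w := S.addr r) (l := Nat.bits i)
      (s := (s.putWork (S.addr r) (Nat.bits i).length (wordTape 0 (Nat.bits i))).putMem r
        fun j => (l₀ ++ [b])[j]?) (by simp) (by simp)
    have e3 : (((s.putWork (S.addr r) (Nat.bits i).length (wordTape 0 (Nat.bits i))).putMem r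
        fun j => (l₀ ++ [b])[j]?).putWork (S.addr r) 0 fun _ => none) =
        s.putMem r fun j => (l₀ ++ [b])[j]? := by
      have := s.putWork_eq_self hp hc
      conv_rhs => rw [← this]
      simp [Store.putWork, Store.putMem]
    rw [e3] at r3
    have r4 := hT (l₀ ++ [b]) (s.putMem r fun j => (l₀ ++ [b])[j]?) (by simpa) (by simpa) (by simpa)
      (by simp)
    refine (r1.bind (r2.bind (r3.bind r4))).congr ?_ le_rfl
    simp [Store.putMem]

end Prog

/-- The tapes of `M`, an input tape, its address tape `inr false`, and a tape of marks. -/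
def loopSig (M : RATM) : TapeSig :=
  letI := M.finWork
  letI := M.finMem
  { Work := M.Work ⊕ Bool
    Mem := M.Mem ⊕ Unit
    addr := fun r => match r with
      | .inl r => .inl (M.addr r)
      | .inr _ => .inr false }

/-! ### Iterating the update machine -/

namespace Loop

variable {M : RATM}

def input : (loopSig M).Mem := .inr ()
def mem (r : M.Mem) : (loopSig M).Mem := .inl r
def counter : (loopSig M).Work := .inr false
def marks : (loopSig M).Work := .inr true

theorem counter_ne_marks : (counter : (loopSig M).Work) ≠ marks :=
  fun h => absurd (Sum.inr.inj h) (by decide)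

/-- Run `M` on its own tapes. -/
noncomputable def lift (M : RATM) : Prog (loopSig M) Unit :=
  letI := M.finState
  { State := M.State
    start := M.start
    δ := fun q wr mr => match M.δ q (fun w => wr (.inl w)) (fun r => mr (.inl r)) with
      | none => .inr ()
      | some (q', a, b) => .inl (q', Sum.elim a fun i => (wr (.inr i), .stay),
          Sum.elim b fun i => mr (.inr i)) }

/-- The tapes of the configuration `c`, with `a` on the address tape of the input, `m` marks, and
`x` on the input tape. -/
noncomputable def embed (c : M.Cfg) (a m : ℕ) (x : ℕ → Option Bool) : Store (loopSig M) where
  pos := Sum.elim c.pos fun _ => 0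
  work := Sum.elim c.work fun b => if b then visited m else bitsTape a
  mem := Sum.elim c.mem fun _ => x

/-- Counter, marks and input are written back unchanged in each step, so a run of `M` is a run on
the larger set of tapes. -/
theorem runsIn_lift {c c' : M.Cfg} {T : ℕ} (h : RATM.HaltsWithin c c' T)
    (hc : c.state = M.start) (a m : ℕ) (x : ℕ → Option Bool) :
    (lift M).RunsIn (embed c a m x) () (embed c' a m x) T := by
  have key := h.runsIn (p := lift M)
    (fun _ c q s => q = c.state ∧ s = embed c a m x) (s := embed c a m x) ⟨hc.symm, rfl⟩ ?_ ?_
  · obtain ⟨r, n, q, s', -, ⟨-, rfl⟩, hr⟩ := key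
    exact hr
  · rintro n c c' q s ⟨rfl, rfl⟩ hs
    obtain ⟨⟨q', b, d⟩, hδ, rfl⟩ := Option.map_eq_some_iff.1 hs
    have hδ' : M.δ c.state (fun w => (embed c a m x).workRead (.inl w))
        (fun r => (embed c a m x).memRead (.inl r)) = some (q', b, d) := hδ
    refine ⟨q', _, by simp only [lift, hδ']; rfl, rfl, ?_⟩
    ext u : 2
    · cases u <;> rfl
    · cases u with
      | inl w => rfl
      | inr b => exact Function.update_eq_self (β := fun _ : ℕ => Option Bool) _ _
    · cases u with
      | inl w => rfl
      | inr b => exact Function.update_eq_self (β := fun _ : ℕ => Option Bool) _ _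
  · rintro n c q s ⟨rfl, rfl⟩ hs
    have hδ' : M.δ c.state (fun w => (embed c a m x).workRead (.inl w))
        (fun r => (embed c a m x).memRead (.inl r)) = none := Option.map_eq_none_iff.1 hs
    exact ⟨(), by simp only [lift, hδ']⟩

/-- Run `M` once for every cell of the input but the first. -/
noncomputable def loop (M : RATM) : Prog (loopSig M) Unit :=
  Prog.iter (fun _ : Unit => (Prog.increment counter marks).bind fun _ =>
    (Prog.test fun _ mr => (mr input).isSome).bind fun b =>
      if b then (lift M).bind fun _ => Prog.pure (.inl ()) else Prog.pure (.inr ())) ()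

theorem runsIn_increment_embed (c : M.Cfg) (a m : ℕ) (x : ℕ → Option Bool) :
    ∃ k m', onesCount (a + 1) + k = onesCount a + 1 ∧
      (Prog.increment counter marks).RunsIn (embed c a m x) () (embed c (a + 1) m' x)
        (4 * k + 3) := by
  obtain ⟨k, hk, -, r⟩ := Prog.runsIn_increment counter_ne_marks (s := embed c a m x) (a := a)
    (m := m) rfl rfl rfl rfl
  refine ⟨k, max m k, hk, r.congr ?_ le_rfl⟩
  rw [show (embed c a m x).putWork counter 0 (bitsTape (a + 1)) = embed c (a + 1) m x from
    Store.putWork_eq rfl rfl (fun u _ => by cases u <;> rfl)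
      (fun u hu => by rcases u with u | u | u <;> first | rfl | exact absurd rfl hu) rfl]
  exact Store.putWork_eq rfl rfl (fun u _ => by cases u <;> rfl)
    (fun u hu => by rcases u with u | u | u <;> first | rfl | exact absurd rfl hu) rfl

/-- A run of `M` leaves all tapes but `io` blank and all heads at cell `0`, so the next run only
needs the start state. With `a` on the counter, `k` runs remain; the term `4 * onesCount a` is the
potential that pays for the carries. -/
theorem runsIn_loop {io : M.Mem} {L : ℕ → List Bool} {τ : ℕ → ℕ} {x : List Bool}
    (hM : ∀ i, ∃ q, RATM.HaltsWithin (RATM.cfgOf M.start io (L i)) (RATM.cfgOf q io (L (i + 1)))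
      (τ i)) (k : ℕ) : ∀ (a m : ℕ) (q : M.State), a + k + 1 = x.length →
    ∃ s' T, (loop M).RunsIn (embed (RATM.cfgOf q io (L a)) a m fun i => x[i]?) () s' T ∧
      s'.mem (mem io) = (fun i => (L (a + k))[i]?) ∧
      T ≤ 4 * onesCount a + 20 * (k + 1) + ∑ i ∈ Finset.range k, τ (a + i) := by
  induction k with
  | zero =>
    intro a m q ha
    obtain ⟨j, m', hj, r1⟩ := runsIn_increment_embed (RATM.cfgOf q io (L a)) a m fun i => x[i]?
    have r2 := Prog.runsIn_test (fun _ mr => (mr input).isSome)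
      (embed (RATM.cfgOf q io (L a)) (a + 1) m' fun i => x[i]?)
    -- The counter has reached `x.length`, the first blank cell of the input. Incrementing before
    -- the test gives one run fewer than there are input cells.
    have e : (embed (RATM.cfgOf q io (L a)) (a + 1) m' fun i => x[i]?).memRead input = none := by
      change x[RATM.number (bitsTape (a + 1))]? = none
      simp; omega
    rw [e] at r2
    refine ⟨_, _, Prog.RunsIn.iter_exit (r1.bind (r2.bind (Prog.runsIn_pure (Sum.inr ()) _))), ?_, ?_⟩
    · simp [embed, mem, RATM.cfgOf]
    · simp; omega
  | succ k ih =>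
    intro a m q ha
    obtain ⟨j, m', hj, r1⟩ := runsIn_increment_embed (RATM.cfgOf q io (L a)) a m fun i => x[i]?
    have r2 := Prog.runsIn_test (fun _ mr => (mr input).isSome)
      (embed (RATM.cfgOf q io (L a)) (a + 1) m' fun i => x[i]?)
    have e : ((embed (RATM.cfgOf q io (L a)) (a + 1) m' fun i => x[i]?).memRead input).isSome
        = true := by
      change (x[RATM.number (bitsTape (a + 1))]?).isSome = true
      simp; omega
    rw [e] at r2
    obtain ⟨q', h⟩ := hM a
    have r3 := runsIn_lift h rfl (a + 1) m' fun i => x[i]?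
    obtain ⟨s', T, r4, hs', hT⟩ := ih (a + 1) m' q' (by omega)
    refine ⟨s', _, Prog.RunsIn.iter_step
      (r1.bind (r2.bind (r3.bind (Prog.runsIn_pure (Sum.inl ()) _)))) r4, ?_, ?_⟩
    · rw [hs', show a + 1 + k = a + (k + 1) by omega]
    · rw [Finset.sum_range_succ']
      rw [Finset.sum_congr rfl fun i _ => show τ (a + (i + 1)) = τ (a + 1 + i) by
        rw [add_assoc, add_comm 1]]
      have : τ (a + 0) = τ a := rfl
      omega

/-- Write the word `l` on the tape `io` of `M` and enter the loop. -/
noncomputable def generator (M : RATM) (io : M.Mem) (l : List Bool) : Prog (loopSig M) Unit :=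
  (Prog.write marks (some true) .stay).bind fun _ =>
    (Prog.writeMem (mem io) 0 l).bind fun _ => loop M

theorem runsIn_generator {io : M.Mem} {L : ℕ → List Bool} {τ : ℕ → ℕ}
    (hM : ∀ i, ∃ q, RATM.HaltsWithin (RATM.cfgOf M.start io (L i)) (RATM.cfgOf q io (L (i + 1)))
      (τ i)) : ∃ K, ∀ (k : ℕ) (x : List Bool), k + 1 = x.length →
    ∃ s', (generator M io (L 0)).RunsIn (Store.init input x) () s'
        (K + 20 * (k + 1) + ∑ i ∈ Finset.range k, τ i) ∧
      s'.mem (mem io) = fun i => (L k)[i]? := by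
  obtain ⟨K, hK⟩ := Prog.runsIn_writeMem (mem io) (L 0) 0
  refine ⟨K + 10, fun k x hx => ?_⟩
  set s := Store.init (S := loopSig M) input x with hs
  have r1 := Prog.runsIn_write (S := loopSig M) marks (some true) .stay s
  have e1 : Function.update (s.work marks) (s.pos marks) (some true) = visited 0 := by
    funext i
    cases i <;> simp [hs, Store.init, visited]
  have e0 : RATM.movePos .stay (s.pos marks) = 0 := rfl
  rw [e1, e0] at r1
  have r2 := hK [] (s.putWork marks 0 (visited 0)) rfl
    (by rw [Store.putWork_pos_ne]; · rfl
        · exact fun h => by cases h)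
    (by rw [Store.putWork_work_ne]; · rfl
        · exact fun h => by cases h)
    (by funext i; simp [hs, Store.init, mem, input])
  have e2 : ((s.putWork marks 0 (visited 0)).putMem (mem io) fun j => ([] ++ L 0)[j]?) =
      embed (RATM.cfgOf M.start io (L 0)) 0 0 fun i => x[i]? := by
    rw [show s.putWork marks 0 (visited 0) = embed (RATM.cfgOf M.start io []) 0 0 fun i => x[i]? from
      Store.putWork_eq rfl rfl (fun u _ => by cases u <;> rfl)
        (fun u hu => by
          rcases u with u | u | u
          · rfl
          · exact bitsTape_zero.symm
          · exact absurd rfl hu)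
        (by
          funext r i
          cases r with
          | inl r => simp [hs, Store.init, embed, input, RATM.cfgOf]
          | inr r => exact if_pos rfl)]
    refine Store.putMem_eq ?_ rfl rfl fun r hr => ?_
    · simp [embed, mem, RATM.cfgOf]
    · cases r with
      | inl r =>
        have : r ≠ io := fun h => hr (by rw [h]; rfl)
        simp [embed, RATM.cfgOf, this]
      | inr r => rfl
  rw [e2] at r2
  obtain ⟨s', T, r3, hs', hT⟩ := runsIn_loop (x := x) hM k 0 0 M.start (by omega)
  refine ⟨s', (r1.bind (r2.bind r3)).mono ?_, by simpa using hs'⟩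
  simp only [Nat.zero_add, show onesCount 0 = 0 by simp [onesCount]] at hT
  omega

end Loop

/-- Here `1ⁿ` serves only as a unary count of the updates from `C 1` to `C n`. Index `i` of the loop
stands for the circuit `C (i + 1)`, whence `succPNat`. -/
theorem LocallyUniform.globallyUniform {B : GateBasis} {C : CircuitFamily B} {T T' : ℕ+ → ℝ}
    (h : LocallyUniform T C)
    (hT : ∀ τ : ℕ+ → ℕ, (fun n => (τ n : ℝ)) =O[atTop] T → ∀ K : ℕ,
      (fun n : ℕ+ => ((K + 20 * n + ∑ i ∈ Finset.range (n - 1), τ i.succPNat : ℕ) : ℝ))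
        =O[atTop] T') :
    GloballyUniform T' C := by
  obtain ⟨M, io, τ, hτ, hM⟩ := h
  obtain ⟨K, hK⟩ := Loop.runsIn_generator (L := fun i => (C i.succPNat).enc)
    (τ := fun i => τ i.succPNat) fun i => hM i.succPNat
  refine ⟨(Loop.generator M io (C 1).enc).toRATM, Loop.input, Loop.mem io, _, Sum.inr_ne_inl,
    hT τ hτ (K + 1), fun n => ?_⟩
  have hn : (n : ℕ) - 1 + 1 = n := Nat.sub_add_cancel n.2
  obtain ⟨s', r, hs'⟩ := hK (n - 1) (List.replicate n true) (by simpa using hn)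
  refine ⟨_, r.haltsWithin.mono (by omega), ?_⟩
  have : ((n : ℕ) - 1).succPNat = n := PNat.eq (by simpa using hn)
  rw [this] at hs'
  exact hs'

/-! ### Time correspondence -/

/-- By monotonicity each term is at most `C * t n ^ a`, up to finitely many exceptions. There are
fewer than `n ≤ c * t n` terms, so the sum is `O(t n ^ (1 + a))`. -/
theorem isBigO_sum_rpow {t : ℕ+ → ℝ} (ht : ∀ n, 0 < t n) (hmono : Monotone t)
    (hn : (fun n : ℕ+ => (n : ℝ)) =O[atTop] t) {a k : ℝ} (ha : 0 ≤ a) (hak : 1 + a ≤ k)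
    {τ : ℕ+ → ℕ} (hτ : (fun n => (τ n : ℝ)) =O[atTop] fun n => t n ^ a) (K : ℕ) :
    (fun n : ℕ+ => ((K + 20 * n + ∑ i ∈ Finset.range (n - 1), τ i.succPNat : ℕ) : ℝ))
      =O[atTop] fun n => t n ^ k := by
  obtain ⟨c, hc, hcn⟩ := hn.exists_pos
  obtain ⟨C, hC, hCn⟩ := hτ.exists_pos
  obtain ⟨N, hN⟩ := eventually_atTop.1 hCn.bound
  have hN' : ∀ n ≥ N, (τ n : ℝ) ≤ C * t n ^ a := fun n h => by
    simpa [abs_of_pos (Real.rpow_pos_of_pos (ht n) a)] using hN n h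
  -- `S` bounds the contribution of the small indices, where the asymptotic bound on `τ` may fail.
  set S : ℝ := ∑ i ∈ Finset.range N, (τ i.succPNat : ℝ) with hS
  have hS0 : 0 ≤ S := Finset.sum_nonneg fun _ _ => Nat.cast_nonneg _
  have hsum : ∀ n : ℕ+, ∑ i ∈ Finset.range (n - 1), (τ i.succPNat : ℝ) ≤ S + n * (C * t n ^ a) := by
    intro n
    have hpos : 0 ≤ C * t n ^ a := mul_nonneg hC.le (Real.rpow_nonneg (ht n).le a)
    calc ∑ i ∈ Finset.range (n - 1), (τ i.succPNat : ℝ)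
        ≤ ∑ i ∈ Finset.range (n - 1),
            ((if i ∈ Finset.range N then (τ i.succPNat : ℝ) else 0) + C * t n ^ a) := by
          refine Finset.sum_le_sum fun i hi => ?_
          split_ifs with h
          · linarith
          · rw [zero_add]
            refine (hN' _ ?_).trans (mul_le_mul_of_nonneg_left
              (Real.rpow_le_rpow (ht _).le (hmono ?_) ha) hC.le)
            · rw [ge_iff_le, ← PNat.coe_le_coe, Nat.succPNat_coe]
              rw [Finset.mem_range] at h
              omega
            · rw [← PNat.coe_le_coe, Nat.succPNat_coe]
              rw [Finset.mem_range] at hi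
              omega
      _ ≤ S + n * (C * t n ^ a) := by
          rw [Finset.sum_add_distrib, Finset.sum_ite_mem, Finset.sum_const, nsmul_eq_mul,
            Finset.card_range]
          refine add_le_add (Finset.sum_le_sum_of_subset_of_nonneg Finset.inter_subset_right
            fun _ _ _ => Nat.cast_nonneg _) (mul_le_mul_of_nonneg_right ?_ hpos)
          exact_mod_cast Nat.sub_le _ _
  -- From `c ≤ n ≤ c * t n` follows `1 ≤ t n`, so that powers of `t n` increase with the exponent
  -- and constants are at most multiples of `t n ^ k`.
  have hlarge : ∀ᶠ n : ℕ+ in atTop, c ≤ (n : ℝ) := by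
    refine eventually_atTop.2 ⟨⌈c⌉₊.succPNat, fun n h => ?_⟩
    rw [← PNat.coe_le_coe, Nat.succPNat_coe] at h
    exact (Nat.le_ceil c).trans (by exact_mod_cast (Nat.le_succ _).trans h)
  refine IsBigO.of_bound (K + S + 20 * c + c * C) ?_
  filter_upwards [hcn.bound, hlarge] with n hn hl
  have hnt : (n : ℝ) ≤ c * t n := by simpa [abs_of_pos (ht n)] using hn
  have h1 : 1 ≤ t n := by
    by_contra h
    push Not at h
    nlinarith
  have hk1 : 1 ≤ t n ^ k := Real.one_le_rpow h1 (by linarith)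
  have hkt : t n ≤ t n ^ k := by
    simpa using Real.rpow_le_rpow_of_exponent_le h1 (show (1 : ℝ) ≤ k by linarith)
  have hka : t n * t n ^ a ≤ t n ^ k := by
    rw [← Real.rpow_one_add' (ht n).le (by linarith)]
    exact Real.rpow_le_rpow_of_exponent_le h1 hak
  have hpa : 0 ≤ C * t n ^ a := mul_nonneg hC.le (Real.rpow_nonneg (ht n).le a)
  rw [Real.norm_of_nonneg (Nat.cast_nonneg _), Real.norm_of_nonneg (by linarith)]
  push_cast
  have e1 : (K + S) * 1 ≤ (K + S) * t n ^ k :=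
    mul_le_mul_of_nonneg_left hk1 (add_nonneg (Nat.cast_nonneg _) hS0)
  have e2 : (n : ℝ) ≤ c * t n ^ k := hnt.trans (mul_le_mul_of_nonneg_left hkt hc.le)
  have e3 : n * (C * t n ^ a) ≤ c * C * t n ^ k :=
    calc n * (C * t n ^ a) ≤ c * t n * (C * t n ^ a) := mul_le_mul_of_nonneg_right hnt hpa
      _ = c * C * (t n * t n ^ a) := by ring
      _ ≤ c * C * t n ^ k := mul_le_mul_of_nonneg_left hka (by positivity)
  have := hsum n
  linarith

theorem globalRC_subset_DTIME (d : ℕ) (t T : ℕ+ → ℝ) : globalRC d t T ⊆ DTIME T := by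
  rintro f ⟨B, -, C, hC, hT⟩
  exact mem_DTIME_of_globallyUniform hC.computes hT

theorem localRC_subset_DTIME {d : ℕ} (hd : 2 ≤ d) {t : ℕ+ → ℝ} (ht : ∀ n, 0 < t n)
    (hmono : Monotone t) (hn : (fun n : ℕ+ => (n : ℝ)) =O[atTop] t) {k : ℝ}
    (hk : (d : ℝ) / (d - 1) ≤ k) (t' : ℕ+ → ℝ) :
    localRC d t' (fun n => t n ^ (k / d)) ⊆ DTIME fun n => t n ^ k := by
  rintro f ⟨B, -, C, hC, hT⟩
  have hd' : (2 : ℝ) ≤ d := by exact_mod_cast hd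
  have hk' : d ≤ k * (d - 1) := (div_le_iff₀ (by linarith)).1 hk
  have hk0 : 0 ≤ k := (div_nonneg (by linarith) (by linarith)).trans hk
  refine mem_DTIME_of_globallyUniform hC.computes (hT.globallyUniform fun τ hτ K =>
    isBigO_sum_rpow ht hmono hn (by positivity) ?_ hτ K)
  -- After clearing denominators, `1 + k / d ≤ k` is the hypothesis `d ≤ k * (d - 1)`.
  have : 1 + k / d = (d + k) / d := by field_simp
  rw [this, div_le_iff₀ (by linarith)]
  linarith

theorem mainTheorem5 (d : ℕ) (hd : 1 ≤ d) (t : ℕ+ → ℝ) (ht : ∀ n, 0 < t n) :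
    -- local uniformity
    (2 ≤ d → Monotone t → (fun n : ℕ+ => (n : ℝ)) =O[atTop] t →
      ∀ k : ℝ, (d : ℝ) / (d - 1) ≤ k →
        localRC d (fun n => t n ^ (k / d)) (fun n => t n ^ (k / d)) ⊆
          DTIME (fun n => t n ^ k)) ∧
    -- global uniformity
    (∀ k : ℝ, globalRC d (fun n => t n ^ (k / d)) (fun n => t n ^ k) ⊆
      DTIME (fun n => t n ^ k)) ∧
    -- ideal time complexity
    (2 ≤ d →
      localRC d (fun n => (n : ℝ) ^ (1 / ((d : ℝ) - 1))) (fun n => (n : ℝ) ^ (1 / ((d : ℝ) - 1))) ⊆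
        DTIME (fun n => (n : ℝ) ^ ((d : ℝ) / (d - 1)))) := by
  refine ⟨fun h2 hmono hn k hk => localRC_subset_DTIME h2 ht hmono hn hk _,
    fun k => globalRC_subset_DTIME d _ _, fun h2 => ?_⟩
  have h0 : (d : ℝ) ≠ 0 := by
    have : d ≠ 0 := by omega
    exact_mod_cast this
  have := localRC_subset_DTIME h2 (t := fun n : ℕ+ => (n : ℝ)) (fun n => by exact_mod_cast n.2)
    (fun a b h => Nat.cast_le.2 (PNat.coe_le_coe a b |>.2 h)) (isBigO_refl _ _) (k := (d : ℝ) / (d - 1)) le_rfl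
    (fun n => (n : ℝ) ^ (1 / ((d : ℝ) - 1)))
  rwa [show (d : ℝ) / (d - 1) / d = 1 / (d - 1) by
    rw [div_div, mul_comm, ← div_div, div_self h0]] at this
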